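/- An operational-probabilistic theory consists of systems and transformations forming a symmetric monoidal category with unit the trivial system $\mathrm I$, together with (i) a map sending each scalar (transformation $\mathrm I\to\mathrm I$) to a probability in $[0,1]$, multiplicative under composition, and (ii) a notion of test, i.e. a distinguished finite family $\{\mathcal C_i\}_{i\in\mathsf X}$ of transformations $\mathrm A\to\mathrm B$. Every transformation belongs to a test; tests are closed under parallel composition, under sequential composition (where the later test may depend on the outcome of the earlier one) and under coarse-graining; the tests of $\mathrm I$ are exactly the finite probability distributions; identities, swaps and the structural isomorphisms are channels (a channel is the transformation of a one-outcome test); and transformations giving equal probabilities in all circuits are equal. Sums and multiples of transformations are meant at the level of the probabilities of all circuits. States (effects) of $\mathrm A$ are the transformations $\mathrm I\to\mathrm A$ ($\mathrm A\to\mathrm I$), $(a|\rho)$ is the probability of the effect $a$ on the state $\rho$, and $\mathsf{St}_{\mathbb R}(\mathrm A)$, $\mathsf{Eff}_{\mathbb R}(\mathrm A)$ are the real vector spaces they span, with the pairing extended bilinearly. The norm of a state (effect) is its largest pairing with an effect (state), as a supremum; it is normalised if its norm is $1$. A transformation $\mathcal C$ is pure if, whenever some of the members of a test sum to $\mathcal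 C$, these are of the form $p_j\mathcal C$ with $\{p_j\}$ a probability distribution. Assume that $\mathsf{St}_{\mathbb R}(\mathrm A)$ is finite-dimensional and the set of states of $\mathrm A$ is closed for every system $\mathrm A$, and that the theory is a sharp theory with purification: * (Causality) every system $\mathrm A$ has a unique deterministic effect $u_{\mathrm A}$, i.e. a unique effect that is a channel; * (Purity Preservation) sequential and parallel compositions of pure transformations are pure; * (Pure Sharpness) for every system there is a pure effect $a$ and a state $\rho$ with $(a|\rho)=1$; * (Purification) every normalised state $\rho$ of a system $\mathrm A$ is the marginal $(\mathcal I_{\mathrm A}\otimes u_{\mathrm B})\Psi$ of a normalised pure state $\Psi$ of some $\mathrm A\otimes\mathrm B$, and any two such $\Psi,\Psi'$ on the same $\mathrm A\otimes\mathrm B$ satisfy $\Psi'=(\mathcal I_{\mathrm A}\otimes\mathcal U)\Psi$ for a reversible channel $\mathcal U$ on $\mathrm B$. Then for every system $\mathrm A$: 1. There is a unique bijection $\dagger$ from normalised pure states to normalised pure effects of $\mathrm A$ such that, for every normalised pure state $\alpha$, $\alpha^\dagger$ is the unique normalised pure effect with $(\alpha^\dagger|\alpha)=1$; and $\dagger$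 extends uniquely to a linear isomorphism $\mathsf{St}_{\mathbb R}(\mathrm A)\to\mathsf{Eff}_{\mathbb R}(\mathrm A)$, $\xi\mapsto\xi^\dagger$. 2. The map $\langle\xi,\eta\rangle:=(\xi^\dagger|\eta)$ is an inner product (bilinear, symmetric and positive definite) on $\mathsf{St}_{\mathbb R}(\mathrm A)$. In particular $(\rho^\dagger|\sigma)=(\sigma^\dagger|\rho)$ for all states $\rho,\sigma$, and transition probabilities are symmetric: $(\alpha^\dagger|\beta)=(\beta^\dagger|\alpha)$ for all normalised pure states $\alpha,\beta$. -/

import Mathlib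

open CategoryTheory MonoidalCategory

universe v u

/-- The primitive data of an operational-probabilistic theory.  The objects of the symmetric monoidal
category `C` are the systems, its morphisms `A ⟶ B` the transformations, and its unit `𝟙_ C` the
trivial system.  `prob` is the probability of a circuit without external wires, and `IsTest D`
says that the family `D` of transformations is a test with outcome set `X`. -/
structure OPTData (C : Type u) [Category.{v} C] [MonoidalCategory C] [SymmetricCategory C] where
  prob : (𝟙_ C ⟶ 𝟙_ C) → ℝ
  IsTest : ∀ {X : Type} {A B : C}, (X → (A ⟶ B)) → Prop

namespace OPTData

variable {C : Type u} [Category.{v} C] [MonoidalCategory C] [SymmetricCategory C] (T : OPTData C)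

/-- States of `A` : transformations from the trivial system. -/
abbrev St (_T : OPTData C) (A : C) := 𝟙_ C ⟶ A

/-- Effects on `A` : transformations to the trivial system. -/
abbrev Eff (_T : OPTData C) (A : C) := A ⟶ 𝟙_ C

/-- The number `(a|ρ)`. -/
def pair {A : C} (a : T.Eff A) (ρ : T.St A) : ℝ := T.prob (ρ ≫ a)

/-- The number `(a| f ⊗ id_S |ρ)`, for an ancilla `S`. -/
def circ {A B : C} (f : A ⟶ B) (S : C) (ρ : T.St (A ⊗ S)) (a : T.Eff (B ⊗ S)) : ℝ :=
  T.prob (ρ ≫ f ▷ S ≫ a)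

/-- `f = ∑ x ∈ s, D x`, as an identity between the probabilities of all circuits. -/
def IsSum {X : Type} {A B : C} (s : Finset X) (D : X → (A ⟶ B)) (f : A ⟶ B) : Prop :=
  ∀ (S : C) (ρ : T.St (A ⊗ S)) (a : T.Eff (B ⊗ S)),
    T.circ f S ρ a = ∑ x ∈ s, T.circ (D x) S ρ a

/-- `g = p f`, as an identity between the probabilities of all circuits. -/
def IsScale {A B : C} (p : ℝ) (f g : A ⟶ B) : Prop :=
  ∀ (S : C) (ρ : T.St (A ⊗ S)) (a : T.Eff (B ⊗ S)), T.circ g S ρ a = p * T.circ f S ρ a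

/-- Channels are the deterministic transformations: those of one-outcome tests. -/
def IsChannel {A B : C} (f : A ⟶ B) : Prop := T.IsTest (fun _ : Unit => f)

/-- Reversible channels. -/
def IsReversible {A B : C} (U : A ⟶ B) : Prop :=
  T.IsChannel U ∧ ∃ V : B ⟶ A, T.IsChannel V ∧ U ≫ V = 𝟙 A ∧ V ≫ U = 𝟙 B

/-- The laws of an operational-probabilistic theory. -/
structure IsOPT : Prop where
  /-- scalars are probabilities -/
  prob_mem : ∀ s, T.prob s ∈ Set.Icc (0 : ℝ) 1
  prob_comp : ∀ s t, T.prob (s ≫ t) = T.prob s * T.prob t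
  /-- tests have finitely many outcomes, and every transformation is an outcome of a test -/
  finite : ∀ {X : Type} {A B : C} (D : X → (A ⟶ B)), T.IsTest D → Finite X
  exists_test : ∀ {A B : C} (f : A ⟶ B), ∃ (X : Type) (D : X → (A ⟶ B)),
    T.IsTest D ∧ ∃ x, D x = f
  /-- the tests of the trivial system are the probability distributions -/
  scalar_test : ∀ {X : Type} [Fintype X] (D : X → (𝟙_ C ⟶ 𝟙_ C)), T.IsTest D →
    ∑ x, T.prob (D x) = 1
  exists_scalar_test : ∀ {X : Type} [Fintype X] (p : X → ℝ), (∀ x, 0 ≤ p x) → ∑ x, p x = 1 →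
    ∃ D : X → (𝟙_ C ⟶ 𝟙_ C), T.IsTest D ∧ ∀ x, T.prob (D x) = p x
  /-- wires and their rearrangements are deterministic -/
  channel_id : ∀ A : C, T.IsChannel (𝟙 A)
  channel_braiding : ∀ A B : C, T.IsChannel (β_ A B).hom
  channel_associator : ∀ A B D : C, T.IsChannel (α_ A B D).hom ∧ T.IsChannel (α_ A B D).inv
  channel_leftUnitor : ∀ A : C, T.IsChannel (λ_ A).hom ∧ T.IsChannel (λ_ A).inv
  channel_rightUnitor : ∀ A : C, T.IsChannel (ρ_ A).hom ∧ T.IsChannel (ρ_ A).inv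
  /-- sequential composition of tests, where the second test may be chosen according to the
  outcome of the first -/
  test_comp : ∀ {A B E : C} {X : Type} {Y : X → Type} (D : X → (A ⟶ B))
    (F : ∀ x, Y x → (B ⟶ E)), T.IsTest D → (∀ x, T.IsTest (F x)) →
    T.IsTest (fun z : Σ x, Y x => D z.1 ≫ F z.1 z.2)
  /-- parallel composition of tests -/
  test_tensor : ∀ {A B A' B' : C} {X Y : Type} (D : X → (A ⟶ B)) (F : Y → (A' ⟶ B')),
    T.IsTest D → T.IsTest F → T.IsTest (fun z : X × Y => D z.1 ⊗ₘ F z.2)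
  /-- coarse-graining of tests, along the partition of `Y` into the fibres of `π` -/
  coarse : ∀ {A B : C} {X Y : Type} (D : Y → (A ⟶ B)) (π : Y → X), Function.Surjective π →
    T.IsTest D → ∃ F : X → (A ⟶ B), T.IsTest F ∧
      ∀ (x : X) (s : Finset Y), (∀ y, y ∈ s ↔ π y = x) → T.IsSum s D (F x)
  /-- transformations which give the same probabilities in all circuits are equal -/
  separated : ∀ {A B : C} (f g : A ⟶ B),
    (∀ (S : C) (ρ : T.St (A ⊗ S)) (a : T.Eff (B ⊗ S)), T.circ f S ρ a = T.circ g S ρ a) → f = g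

/-- A transformation is pure if each of its refinements `(D y)`, `y ∈ s` (a cell of a test `D`
whose sum is `f`) is trivial. -/
def IsPure {A B : C} (f : A ⟶ B) : Prop :=
  ∀ {Y : Type} (D : Y → (A ⟶ B)) (s : Finset Y), T.IsTest D → s.Nonempty → T.IsSum s D f →
    ∃ p : Y → ℝ, (∀ y ∈ s, 0 ≤ p y) ∧ ∑ y ∈ s, p y = 1 ∧ ∀ y ∈ s, T.IsScale (p y) f (D y)

/-- The norm of a state. -/
noncomputable def stNorm {A : C} (ρ : T.St A) : ℝ := ⨆ a : T.Eff A, T.pair a ρ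

/-- The norm of an effect. -/
noncomputable def effNorm {A : C} (a : T.Eff A) : ℝ := ⨆ ρ : T.St A, T.pair a ρ

/-- Normalised pure states. -/
def PurSt₁ (A : C) := {α : T.St A // T.IsPure α ∧ T.stNorm α = 1}

/-- Normalised pure effects. -/
def PurEff₁ (A : C) := {a : T.Eff A // T.IsPure a ∧ T.effNorm a = 1}

/-- A state as a vector: the family of its probabilities. -/
def stFun {A : C} (ρ : T.St A) : T.Eff A → ℝ := fun a => T.pair a ρ

/-- The real vector space spanned by the states. -/
def StR (A : C) : Submodule ℝ (T.Eff A → ℝ) := Submodule.span ℝ (Set.range T.stFun)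

/-- A state as an element of the span of states. -/
def stVec {A : C} (ρ : T.St A) : T.StR A := ⟨T.stFun ρ, Submodule.subset_span ⟨ρ, rfl⟩⟩

/-- An effect as a linear functional on the span of states, with value `(a|ρ)` at `ρ`. -/
def effFun {A : C} (a : T.Eff A) : Module.Dual ℝ (T.StR A) :=
  (LinearMap.proj a).comp (T.StR A).subtype

theorem effFun_stVec {A : C} (a : T.Eff A) (ρ : T.St A) :
    T.effFun a (T.stVec ρ) = T.pair a ρ := rfl

/-- The real vector space spanned by the effects. -/
def EffR (A : C) : Submodule ℝ (Module.Dual ℝ (T.StR A)) := Submodule.span ℝ (Set.range T.effFun)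

/-- An effect as an element of the span of effects. -/
def effVec {A : C} (a : T.Eff A) : T.EffR A := ⟨T.effFun a, Submodule.subset_span ⟨a, rfl⟩⟩

/-- The pairing `(X|ξ)` of `X` in the span of effects with `ξ` in the span of states. -/
def pairR {A : C} (X : T.EffR A) (ξ : T.StR A) : ℝ := (X : Module.Dual ℝ (T.StR A)) ξ

/-- Finite systems. -/
def FiniteSystems : Prop := ∀ A : C, FiniteDimensional ℝ (T.StR A)

/-- The set of states of each system is closed. -/
def ClosedStates : Prop := ∀ A : C, IsClosed (Set.range (T.stFun (A := A)))

/-- Causality: every system has exactly one deterministic effect. -/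
def Causality : Prop := ∀ A : C, ∃! e : T.Eff A, T.IsChannel e

/-- Purity Preservation. -/
def PurityPreservation : Prop :=
  (∀ {A B D : C} (f : A ⟶ B) (g : B ⟶ D), T.IsPure f → T.IsPure g → T.IsPure (f ≫ g)) ∧
  (∀ {A B A' B' : C} (f : A ⟶ B) (g : A' ⟶ B'), T.IsPure f → T.IsPure g → T.IsPure (f ⊗ₘ g))

/-- Pure Sharpness. -/
def PureSharpness : Prop :=
  ∀ A : C, ∃ a : T.Eff A, T.IsPure a ∧ ∃ ρ : T.St A, T.pair a ρ = 1

/-- `ρ` is the marginal on `A` of the state `Ψ` of `A ⊗ B`: it results from `Ψ` by applying the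
deterministic effect to `B`. -/
def IsMarginal {A B : C} (Ψ : T.St (A ⊗ B)) (ρ : T.St A) : Prop :=
  ∃ e : T.Eff B, T.IsChannel e ∧ Ψ ≫ A ◁ e ≫ (ρ_ A).hom = ρ

/-- `Ψ` is a purification of `ρ`. -/
def IsPurification {A B : C} (Ψ : T.St (A ⊗ B)) (ρ : T.St A) : Prop :=
  T.IsPure Ψ ∧ T.stNorm Ψ = 1 ∧ T.IsMarginal Ψ ρ

/-- Purification: every normalised state has a purification, and two purifications with the same
purifying system differ by a reversible channel on it. -/
def Purification : Prop :=
  (∀ {A : C} (ρ : T.St A), T.stNorm ρ = 1 → ∃ (B : C) (Ψ : T.St (A ⊗ B)), T.IsPurification Ψ ρ) ∧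
  (∀ {A B : C} (ρ : T.St A) (Ψ Ψ' : T.St (A ⊗ B)), T.stNorm ρ = 1 →
    T.IsPurification Ψ ρ → T.IsPurification Ψ' ρ →
    ∃ U : B ⟶ B, T.IsReversible U ∧ Ψ' = Ψ ≫ A ◁ U)

/-- Sharp theories with purification (with finite systems and closed sets of states). -/
structure IsSharpWithPurification : Prop extends T.IsOPT where
  finiteSystems : T.FiniteSystems
  closedStates : T.ClosedStates
  causality : T.Causality
  purityPreservation : T.PurityPreservation
  pureSharpness : T.PureSharpness
  purification : T.Purification

/-- The dagger of normalised pure states: `d α` is the one and only normalised pure effect that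
occurs on `α` with probability one. -/
def IsPureDagger {A : C} (d : T.PurSt₁ A ≃ T.PurEff₁ A) : Prop :=
  ∀ (α : T.PurSt₁ A) (a : T.PurEff₁ A), T.pair a.1 α.1 = 1 ↔ a = d α

/-- The linear isomorphism `D` extends `d` to the span of states. -/
def IsLinearExtension {A : C} (d : T.PurSt₁ A ≃ T.PurEff₁ A) (D : T.StR A ≃ₗ[ℝ] T.EffR A) :
    Prop :=
  ∀ α : T.PurSt₁ A, D (T.stVec α.1) = T.effVec (d α).1

end OPTData

/-- The map `b` is a (real) inner product on `V`. -/
def IsInnerProduct {V : Type*} [AddCommGroup V] [Module ℝ V] (b : V → V → ℝ) : Prop :=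
  ∃ c : InnerProductSpace.Core ℝ V, ∀ x y, c.inner x y = b x y

/-!
States are treated as vectors of probabilities: `stFun ρ` is the family of all `(a|ρ)`. For each
system these vectors generate a convex cone, whose normalised elements form a compact convex body
with the normalised pure states as extreme points.

**The dagger.** Uniqueness of purification makes the reversible channels act transitively on the
pure states of a system (`exists_reversible_of_isPureState`), so Pure Sharpness provides every
pure state with a pure effect that identifies it (`exists_effect`), and a pure effect occurs with
certainty on a single state (`isPureState_of_pair_eq_one`, `eq_of_pair_eq_one`). The key tool is
`exists_partner`: in a pure bipartite state, the largest weights of pure components of the two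
marginals agree, and the corresponding pure states are steered to by the effects that identify
each other. Applied to a purification of a state invariant under reversible channels, it pairs all
pure states `α` of `A` with pure states of a conjugate system, and proves that the effect `α†`
identifying `α` is unique (`effect_unique`).

**Orthogonality.** The conjugate system represents effects of `A` by states, so that `α†` is the
least effect that is certain on `α` (`dag_le_of_eq_one`), and orthogonality is symmetric. The face
of two orthogonal pure states `o` and `o'` behaves like a ball: a pure state `α` in it has an
antipode `o + o' - α` (`exists_antipode`), every state in it is a mixture of two antipodes
(`exists_eigenstates`), and there is a reversible half turn about the axis through `o` and `o'`
(`exists_flip`), obtained from the uniqueness of purification applied to a purification of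
`(o + o') / 2` and to its antipode.

**Symmetry.** For pure states `α` and `β` of `A`, let `Θ` purify `(α ⊗ o + β ⊗ o') / 2`. The
daggers of two orthogonal pure states `β₀` and `β₁` of the complement of `A` steer `Θ` to `α` and
to `β`. The marginal of `Θ` on that complement has two antipodal eigenstates `τ` and `τ'`. Unless
it is `(β₀ + β₁) / 2`, in which case `(α†|β) = (β†|α) = 0`, the half turn about the axis through
`τ` and `τ'` fixes it and exchanges `β₀` and `β₁`. By uniqueness of purification a reversible
channel of `A` exchanges `α` and `β`, whence `(α†|β) = (β†|α)` (`vec_dag_symm`).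

**The inner product.** Symmetry says that linear relations between pure states also hold between
their daggers, so `†` extends linearly (`exists_linear_dag`). Taking off the largest pure
component of a state, again and again, diagonalises every vector of the span of states: it is a
combination `∑ c i • o i` of orthogonal pure states (`exists_diagonal`). Then
`(ξ†|ξ) = ∑ (c i) ^ 2`, which is positive unless `ξ = 0`.
-/

namespace OPTData

variable {C : Type u} [Category.{v} C] [MonoidalCategory C] [SymmetricCategory C] {T : OPTData C}

/-! ### Circuits with one and two systems -/

section Circuits

variable {A B E S : C}

/-- The effect on `B` obtained by closing all the other wires of a circuit around a state of `B`. -/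
def closeSt (S : C) (ρ : T.St (𝟙_ C ⊗ S)) (a : T.Eff (B ⊗ S)) : T.Eff B :=
  (ρ_ B).inv ≫ B ◁ (ρ ≫ (λ_ S).hom) ≫ a

/-- For states, ancillas are redundant in the definition of a circuit. -/
theorem circ_state (f : T.St B) (S : C) (ρ : T.St (𝟙_ C ⊗ S)) (a : T.Eff (B ⊗ S)) :
    T.circ f S ρ a = T.pair (closeSt S ρ a) f := by
  unfold circ pair closeSt
  congr 1
  have h : f ≫ (ρ_ B).inv = (ρ_ (𝟙_ C)).inv ≫ f ▷ (𝟙_ C) := by simp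
  have h2 : (ρ_ (𝟙_ C)).inv ≫ (𝟙_ C) ◁ (ρ ≫ (λ_ S).hom) = ρ := by
    rw [← unitors_inv_equal, ← leftUnitor_inv_naturality]; simp
  rw [reassoc_of% h, ← whisker_exchange_assoc, reassoc_of% h2]

/-- The state of `A` obtained by closing all the other wires of a circuit around an effect. -/
def closeEff (S : C) (ρ : T.St (A ⊗ S)) (e : T.Eff (𝟙_ C ⊗ S)) : T.St A :=
  ρ ≫ A ◁ ((λ_ S).inv ≫ e) ≫ (ρ_ A).hom

theorem circ_effect (a : T.Eff A) (S : C) (ρ : T.St (A ⊗ S)) (e : T.Eff (𝟙_ C ⊗ S)) :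
    T.circ a S ρ e = T.pair a (closeEff S ρ e) := by
  unfold circ pair closeEff
  congr 1
  have h2 : (𝟙_ C) ◁ ((λ_ S).inv ≫ e) ≫ (ρ_ (𝟙_ C)).hom = e := by
    rw [← unitors_equal, leftUnitor_naturality]; simp
  simp only [Category.assoc]
  rw [← rightUnitor_naturality, whisker_exchange_assoc, h2]

/-- The state of `B` left by the effect `a` acting on the left half of `Ψ`. -/
def condL (a : T.Eff A) (Ψ : T.St (A ⊗ B)) : T.St B := Ψ ≫ a ▷ B ≫ (λ_ B).hom

/-- The state of `A` left by the effect `b` acting on the right half of `Ψ`. -/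
def condR (b : T.Eff B) (Ψ : T.St (A ⊗ B)) : T.St A := Ψ ≫ A ◁ b ≫ (ρ_ A).hom

/-- The product of two effects. -/
def tenE (a : T.Eff A) (b : T.Eff B) : T.Eff (A ⊗ B) := (a ⊗ₘ b) ≫ (λ_ (𝟙_ C)).hom

/-- The product of two states. -/
def tenS (ρ : T.St A) (σ : T.St B) : T.St (A ⊗ B) := (λ_ (𝟙_ C)).inv ≫ (ρ ⊗ₘ σ)

theorem pair_condL (a : T.Eff A) (b : T.Eff B) (Ψ : T.St (A ⊗ B)) :
    T.pair b (condL a Ψ) = T.pair (tenE a b) Ψ := by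
  unfold pair condL tenE
  congr 1
  simp only [MonoidalCategory.tensorHom_def, Category.assoc, leftUnitor_naturality]

theorem pair_condR (a : T.Eff A) (b : T.Eff B) (Ψ : T.St (A ⊗ B)) :
    T.pair a (condR b Ψ) = T.pair (tenE a b) Ψ := by
  unfold pair condR tenE
  congr 1
  simp only [tensorHom_def', Category.assoc, unitors_equal, rightUnitor_naturality]

theorem pair_tenE_braiding (a : T.Eff A) (b : T.Eff B) (Ψ : T.St (A ⊗ B)) :
    T.pair (tenE b a) (Ψ ≫ (β_ A B).hom) = T.pair (tenE a b) Ψ := by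
  unfold pair tenE
  congr 1
  simp only [Category.assoc]
  rw [← BraidedCategory.braiding_naturality_assoc, braiding_leftUnitor, unitors_equal]

theorem pair_tenE_whiskerLeft (a : T.Eff A) (b : T.Eff E) (V : B ⟶ E) (Ψ : T.St (A ⊗ B)) :
    T.pair (tenE a b) (Ψ ≫ A ◁ V) = T.pair (tenE a (V ≫ b)) Ψ := by
  unfold pair tenE
  congr 1
  simp [tensorHom_def']

theorem pair_tenE_whiskerRight (a : T.Eff E) (b : T.Eff B) (V : A ⟶ E) (Ψ : T.St (A ⊗ B)) :
    T.pair (tenE a b) (Ψ ≫ V ▷ B) = T.pair (tenE (V ≫ a) b) Ψ := by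
  unfold pair tenE
  congr 1
  simp [MonoidalCategory.tensorHom_def]

/-- For a state of three systems, the two right ones may be closed together or one by one. -/
theorem condR_tenE_associator {K : C} (k : T.Eff K) (e : T.Eff E) (Θ : T.St ((A ⊗ K) ⊗ E)) :
    condR (tenE k e) (Θ ≫ (α_ A K E).hom) = condR k (condR e Θ) := by
  unfold condR tenE
  simp only [Category.assoc, tensorHom_def', whiskerLeft_comp]
  have h1 : (α_ A K E).hom ≫ A ◁ K ◁ e = (A ⊗ K) ◁ e ≫ (α_ A K (𝟙_ C)).hom := by simp
  rw [← Category.assoc (α_ A K E).hom, h1, Category.assoc]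
  congr 2
  rw [← rightUnitor_naturality_assoc]
  have h2 : (α_ A K (𝟙_ C)).hom ≫ A ◁ k ▷ (𝟙_ C) = (A ◁ k) ▷ (𝟙_ C) ≫ (α_ A (𝟙_ C) (𝟙_ C)).hom := by
    simp
  rw [← Category.assoc (α_ A K (𝟙_ C)).hom, h2, Category.assoc]
  congr 1
  monoidal

end Circuits

/-! ### Sums, multiples and tests -/

theorem IsSum.comp {X : Type} {A B D E : C} {s : Finset X} {F : X → (B ⟶ D)} {f : B ⟶ D}
    (h : T.IsSum s F f) (g : A ⟶ B) (k : D ⟶ E) :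
    T.IsSum s (fun x => g ≫ F x ≫ k) (g ≫ f ≫ k) := by
  intro S ρ a
  have := h S (ρ ≫ g ▷ S) (k ▷ S ≫ a)
  simpa [circ] using this

theorem IsSum.precomp {X : Type} {A B D : C} {s : Finset X} {F : X → (B ⟶ D)} {f : B ⟶ D}
    (h : T.IsSum s F f) (g : A ⟶ B) : T.IsSum s (fun x => g ≫ F x) (g ≫ f) := by
  simpa using h.comp g (𝟙 D)

theorem IsSum.postcomp {X : Type} {B D E : C} {s : Finset X} {F : X → (B ⟶ D)} {f : B ⟶ D}
    (h : T.IsSum s F f) (k : D ⟶ E) : T.IsSum s (fun x => F x ≫ k) (f ≫ k) := by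
  simpa using h.comp (𝟙 B) k

theorem IsSum.whiskerRight {X : Type} {B D : C} {s : Finset X} {F : X → (B ⟶ D)} {f : B ⟶ D}
    (h : T.IsSum s F f) (E : C) : T.IsSum s (fun x => F x ▷ E) (f ▷ E) := by
  intro S ρ a
  have := h (E ⊗ S) (ρ ≫ (α_ B E S).hom) ((α_ D E S).inv ≫ a)
  simpa [circ, whiskerRight_tensor] using this

theorem IsScale.comp {A B D E : C} {p : ℝ} {f f' : B ⟶ D} (h : T.IsScale p f f') (g : A ⟶ B)
    (k : D ⟶ E) : T.IsScale p (g ≫ f ≫ k) (g ≫ f' ≫ k) := by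
  intro S ρ a
  have := h S (ρ ≫ g ▷ S) (k ▷ S ≫ a)
  simpa [circ] using this

theorem pair_comp {A B : C} (V : A ⟶ B) (ρ : T.St A) (b : T.Eff B) :
    T.pair b (ρ ≫ V) = T.pair (V ≫ b) ρ := by simp [pair]

theorem IsSum.pair {X : Type} {A : C} {s : Finset X} {F : X → T.St A} {f : T.St A}
    (h : T.IsSum s F f) (a : T.Eff A) : T.pair a f = ∑ x ∈ s, T.pair a (F x) := by
  have := h (𝟙_ C) (λ_ (𝟙_ C)).inv ((ρ_ A).hom ≫ a)
  simp only [circ_state] at this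
  have e : closeSt (𝟙_ C) (λ_ (𝟙_ C)).inv ((ρ_ A).hom ≫ a) = a := by
    simp [closeSt]
  simpa [e] using this

theorem isSum_of_pair {X : Type} {A : C} {s : Finset X} {F : X → T.St A} {f : T.St A}
    (h : ∀ a, T.pair a f = ∑ x ∈ s, T.pair a (F x)) : T.IsSum s F f := by
  intro S ρ a
  simp only [circ_state]
  exact h _

theorem IsScale.pair {A : C} {p : ℝ} {f f' : T.St A}
    (h : T.IsScale p f f') (a : T.Eff A) : T.pair a f' = p * T.pair a f := by
  have := h (𝟙_ C) (λ_ (𝟙_ C)).inv ((ρ_ A).hom ≫ a)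
  simp only [circ_state] at this
  have e : closeSt (𝟙_ C) (λ_ (𝟙_ C)).inv ((ρ_ A).hom ≫ a) = a := by
    simp [closeSt]
  simpa [e] using this

theorem isScale_of_pair {A : C} {p : ℝ} {f f' : T.St A}
    (h : ∀ a, T.pair a f' = p * T.pair a f) : T.IsScale p f f' := by
  intro S ρ a
  simp only [circ_state]
  exact h _

namespace IsOPT

variable (hO : T.IsOPT)
include hO

theorem st_ext {A : C} {ρ σ : T.St A} (h : T.stFun ρ = T.stFun σ) : ρ = σ := by
  refine hO.separated _ _ fun S τ a => ?_
  simp only [circ_state]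
  exact congrFun h _

theorem eff_ext {A : C} {a b : T.Eff A} (h : ∀ ρ, T.pair a ρ = T.pair b ρ) : a = b := by
  refine hO.separated _ _ fun S τ e => ?_
  simp only [circ_effect]
  exact h _

theorem pair_nonneg {A : C} (a : T.Eff A) (ρ : T.St A) : 0 ≤ T.pair a ρ := (hO.prob_mem _).1

theorem pair_le_one {A : C} (a : T.Eff A) (ρ : T.St A) : T.pair a ρ ≤ 1 := (hO.prob_mem _).2

theorem eq_of_isSum_singleton {X : Type} {A B : C} {x : X} {F : X → (A ⟶ B)} {f : A ⟶ B}
    (h : T.IsSum {x} F f) : f = F x :=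
  hO.separated _ _ fun S τ a => by simpa using h S τ a

theorem prob_id : T.prob (𝟙 (𝟙_ C)) = 1 := by
  have := hO.scalar_test (X := Unit) _ (hO.channel_id (𝟙_ C))
  simpa using this

theorem prob_channel {f : 𝟙_ C ⟶ 𝟙_ C} (h : T.IsChannel f) : T.prob f = 1 := by
  have := hO.scalar_test (X := Unit) _ h
  simpa using this

theorem scalar_ext {f g : 𝟙_ C ⟶ 𝟙_ C} (h : T.prob f = T.prob g) : f = g :=
  hO.st_ext (A := 𝟙_ C) (by ext a; simp [stFun, pair, hO.prob_comp, h])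

/-- Tests may be relabelled along a bijection of outcomes. -/
theorem relabel {X Y : Type} {A B : C} {D : Y → (A ⟶ B)} (hD : T.IsTest D) (e : X ≃ Y) :
    T.IsTest (fun x => D (e x)) := by
  obtain ⟨F, hF, hS⟩ := hO.coarse D e.symm e.symm.surjective hD
  have : F = fun x => D (e x) := by
    funext x
    exact hO.eq_of_isSum_singleton (hS x {e x} (by
      intro y; rw [Finset.mem_singleton, Equiv.symm_apply_eq]))
  rwa [this] at hF

theorem test_comp_channel {X : Type} {A B E : C} {D : X → (A ⟶ B)} (hD : T.IsTest D)
    {g : X → (B ⟶ E)} (hg : ∀ x, T.IsChannel (g x)) : T.IsTest (fun x => D x ≫ g x) := by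
  have := hO.test_comp (Y := fun _ : X => Unit) D (fun x _ => g x) hD hg
  exact hO.relabel this (Equiv.sigmaUnique X (fun _ => Unit)).symm

theorem channel_comp_test {X : Type} {A B E : C} {f : A ⟶ B} (hf : T.IsChannel f)
    {D : X → (B ⟶ E)} (hD : T.IsTest D) : T.IsTest (fun x => f ≫ D x) := by
  have := hO.test_comp (Y := fun _ : Unit => X) (fun _ => f) (fun _ => D) hf (fun _ => hD)
  exact hO.relabel this (Equiv.uniqueSigma (fun _ : Unit => X)).symm

theorem channel_comp {A B E : C} {f : A ⟶ B} {g : B ⟶ E} (hf : T.IsChannel f)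
    (hg : T.IsChannel g) : T.IsChannel (f ≫ g) :=
  hO.test_comp_channel hf (fun _ => hg)

theorem channel_tensor {A B A' B' : C} {f : A ⟶ B} {g : A' ⟶ B'} (hf : T.IsChannel f)
    (hg : T.IsChannel g) : T.IsChannel (f ⊗ₘ g) :=
  hO.relabel (hO.test_tensor _ _ hf hg) (Equiv.punitProd Unit).symm

theorem test_whiskerRight {X : Type} {A B : C} {D : X → (A ⟶ B)} (hD : T.IsTest D) (E : C) :
    T.IsTest (fun x => D x ▷ E) := by
  have := hO.relabel (hO.test_tensor _ _ hD (hO.channel_id E)) (Equiv.prodPUnit X).symm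
  simpa using this

open Classical in
/-- Every transformation occurs in a test with two outcomes. -/
theorem exists_binary_test {A B : C} (f : A ⟶ B) :
    ∃ D : Bool → (A ⟶ B), T.IsTest D ∧ D true = f := by
  obtain ⟨X, D, hD, x, hx⟩ := hO.exists_test f
  have : Finite X := hO.finite D hD
  have : Fintype X := Fintype.ofFinite X
  -- A second, impossible copy of each outcome makes the coarse-graining surjective.
  obtain ⟨q, hq, hq'⟩ := hO.exists_scalar_test (X := Bool) (fun b => if b then 1 else 0)
    (by intro b; cases b <;> simp) (by simp)
  have hq1 : q true = 𝟙 _ := hO.scalar_ext (by rw [hq', hO.prob_id]; simp)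
  have h1 : T.IsTest (fun z : Bool × X => (λ_ A).inv ≫ (q z.1 ⊗ₘ D z.2) ≫ (λ_ B).hom) := by
    refine hO.channel_comp_test (hO.channel_leftUnitor A).2 ?_
    exact hO.test_comp_channel (hO.test_tensor q D hq hD) fun _ => (hO.channel_leftUnitor B).1
  let π : Bool × X → Bool := fun z => decide (z = (true, x))
  obtain ⟨F, hF, hS⟩ := hO.coarse _ π (by
    intro b; cases b
    · exact ⟨(false, x), by simp [π]⟩
    · exact ⟨(true, x), by simp [π]⟩) h1
  refine ⟨F, hF, ?_⟩
  have := hO.eq_of_isSum_singleton (hS true {(true, x)} (by intro y; simp [π]))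
  rw [this, ← hx, hq1]
  simp

/-- The total coarse-graining of a test is a channel. -/
theorem exists_total {X : Type} [Fintype X] [Nonempty X] {A B : C} {D : X → (A ⟶ B)}
    (hD : T.IsTest D) : ∃ c : A ⟶ B, T.IsChannel c ∧ T.IsSum Finset.univ D c := by
  obtain ⟨F, hF, hS⟩ := hO.coarse D (fun _ => ()) (fun _ => ⟨Classical.arbitrary X, rfl⟩) hD
  exact ⟨F (), hF, hS () Finset.univ (by simp)⟩

end IsOPT

end OPTData

namespace OPTData

variable {C : Type u} [Category.{v} C] [MonoidalCategory C] [SymmetricCategory C] {T : OPTData C}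

/-! ### The cone of states -/

variable (T) in
/-- The cone of states of `A`: non-negative multiples of states, viewed as families of
probabilities. -/
def stCone (A : C) : Set (T.Eff A → ℝ) := {w | ∃ c : ℝ, 0 ≤ c ∧ ∃ ρ : T.St A, w = c • T.stFun ρ}

theorem stFun_apply {A : C} (ρ : T.St A) (a : T.Eff A) : T.stFun ρ a = T.pair a ρ := rfl

theorem stFun_mem_stCone {A : C} (ρ : T.St A) : T.stFun ρ ∈ T.stCone A :=
  ⟨1, zero_le_one, ρ, by simp⟩

theorem smul_mem_stCone {A : C} {w : T.Eff A → ℝ} (hw : w ∈ T.stCone A) {c : ℝ} (hc : 0 ≤ c) :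
    c • w ∈ T.stCone A := by
  obtain ⟨d, hd, ρ, rfl⟩ := hw
  exact ⟨c * d, mul_nonneg hc hd, ρ, by rw [smul_smul]⟩

namespace IsSharpWithPurification

variable (hT : T.IsSharpWithPurification)

/-- The deterministic effect `u_A`. -/
noncomputable def discard (A : C) : T.Eff A := (hT.causality A).choose

theorem discard_channel (A : C) : T.IsChannel (hT.discard A) := (hT.causality A).choose_spec.1

theorem eq_discard {A : C} {e : T.Eff A} (he : T.IsChannel e) : e = hT.discard A :=
  (hT.causality A).choose_spec.2 e he

/-- Normalised states, those of total probability one. -/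
def IsNormalized {A : C} (ρ : T.St A) : Prop := T.stFun ρ (hT.discard A) = 1

include hT

theorem channel_comp_discard {A B : C} {f : A ⟶ B} (hf : T.IsChannel f) :
    f ≫ hT.discard B = hT.discard A :=
  hT.eq_discard (hT.channel_comp hf (hT.discard_channel B))

/-- Every effect `a` has a complement `u - a`. -/
theorem exists_compl {A : C} (a : T.Eff A) : ∃ a' : T.Eff A,
    ∀ ρ, T.pair a ρ + T.pair a' ρ = T.pair (hT.discard A) ρ := by
  obtain ⟨D, hD, rfl⟩ := hT.exists_binary_test a
  obtain ⟨c, hc, hS⟩ := hT.exists_total hD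
  refine ⟨D false, fun ρ => ?_⟩
  rw [← hT.eq_discard hc]
  have h := (hS.precomp ρ).pair (𝟙 (𝟙_ C))
  simp only [pair_comp, Fintype.sum_bool, Category.comp_id] at h
  exact h.symm

theorem pair_le_discard {A : C} (a : T.Eff A) (ρ : T.St A) :
    T.pair a ρ ≤ T.pair (hT.discard A) ρ := by
  obtain ⟨a', h⟩ := hT.exists_compl a
  linarith [h ρ, hT.pair_nonneg a' ρ]

theorem sum_discard_test {A : C} {X : Type} [Fintype X] {D : X → T.St A} (hD : T.IsTest D) :
    ∑ x, T.pair (hT.discard A) (D x) = 1 :=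
  hT.scalar_test _ (hT.test_comp_channel hD fun _ => hT.discard_channel A)

theorem exists_normalized (A : C) : ∃ ρ : T.St A, hT.IsNormalized ρ := by
  obtain ⟨a, -, ρ, h⟩ := hT.pureSharpness A
  exact ⟨ρ, le_antisymm (hT.pair_le_one _ _) (h ▸ hT.pair_le_discard a ρ)⟩

theorem stNorm_eq {A : C} (ρ : T.St A) : T.stNorm ρ = T.pair (hT.discard A) ρ := by
  refine le_antisymm ?_ ?_
  · have : Nonempty (T.Eff A) := ⟨hT.discard A⟩
    exact ciSup_le fun a => hT.pair_le_discard a ρ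
  · exact le_ciSup (f := fun a => T.pair a ρ) ⟨1, by rintro _ ⟨a, rfl⟩; exact hT.pair_le_one a ρ⟩
      (hT.discard A)

theorem isNormalized_iff {A : C} (ρ : T.St A) : hT.IsNormalized ρ ↔ T.stNorm ρ = 1 := by
  rw [hT.stNorm_eq]; rfl

theorem isNormalized_comp {A B : C} {ρ : T.St A} (h : hT.IsNormalized ρ) {f : A ⟶ B}
    (hf : T.IsChannel f) : hT.IsNormalized (ρ ≫ f) := by
  unfold IsNormalized
  rw [stFun_apply, pair_comp, hT.channel_comp_discard hf]
  exact h

theorem stFun_eq_zero {A : C} {ρ : T.St A} (h : T.pair (hT.discard A) ρ = 0) :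
    T.stFun ρ = 0 := by
  ext a
  exact le_antisymm ((hT.pair_le_discard a ρ).trans h.le) (hT.pair_nonneg a ρ)

/-- Normalised states are deterministic: the other outcome of a binary test that prepares one has
probability zero. -/
theorem channel_of_isNormalized {A : C} {ρ : T.St A} (h : hT.IsNormalized ρ) : T.IsChannel ρ := by
  obtain ⟨D, hD, rfl⟩ := hT.exists_binary_test ρ
  obtain ⟨c, hc, hS⟩ := hT.exists_total hD
  have h1 := hT.sum_discard_test hD
  have h2 : T.pair (hT.discard A) (D true) = 1 := h
  rw [Fintype.sum_bool, h2] at h1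
  have h3 := hT.stFun_eq_zero (ρ := D false) (by linarith)
  have : c = D true := by
    refine hT.st_ext ?_
    ext a
    have h4 := hS.pair a
    rw [Fintype.sum_bool] at h4
    have h5 : T.pair a (D false) = 0 := congrFun h3 a
    rw [stFun_apply, stFun_apply, h4, h5, add_zero]
  exact this ▸ hc

theorem exists_scalar {p : ℝ} (h0 : 0 ≤ p) (h1 : p ≤ 1) :
    ∃ q : Bool → (𝟙_ C ⟶ 𝟙_ C), T.IsTest q ∧ T.prob (q true) = p ∧ T.prob (q false) = 1 - p := by
  obtain ⟨q, hq, hq'⟩ := hT.exists_scalar_test (X := Bool) (fun b => if b then p else 1 - p)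
    (by intro b; cases b <;> simp [h0, h1]) (by simp)
  exact ⟨q, hq, by simpa using hq' true, by simpa using hq' false⟩

theorem pair_scalar_comp {A : C} (s : 𝟙_ C ⟶ 𝟙_ C) (ρ : T.St A) (a : T.Eff A) :
    T.pair a (s ≫ ρ) = T.prob s * T.pair a ρ := by
  simp [pair, hT.prob_comp]

/-- A binary test may be followed by one of two binary tests, chosen according to its outcome, and
the intermediate outcome forgotten. -/
theorem exists_coarse_comp {A B : C} {q : Bool → (A ⟶ B)} (hq : T.IsTest q) {E : C}
    {F : Bool → Bool → (B ⟶ E)} (hF : ∀ x, T.IsTest (F x)) :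
    ∃ G : Bool → (A ⟶ E), T.IsTest G ∧
      ∀ y, T.IsSum Finset.univ (fun x => q x ≫ F x y) (G y) := by
  have h1 := hT.test_comp (Y := fun _ : Bool => Bool) q F hq hF
  obtain ⟨G, hG, hS⟩ := hT.coarse _ (fun z : Σ _ : Bool, Bool => z.2)
    (fun b => ⟨⟨true, b⟩, rfl⟩) h1
  refine ⟨G, hG, fun y S τ a => ?_⟩
  have := hS y {⟨true, y⟩, ⟨false, y⟩} (by rintro ⟨x, y'⟩; cases x <;> simp) S τ a
  rw [this, Finset.sum_pair (by simp), Fintype.sum_bool]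

/-- The set of states is convex. -/
theorem exists_mix {A : C} (ρ σ : T.St A) {p : ℝ} (h0 : 0 ≤ p) (h1 : p ≤ 1) :
    ∃ τ : T.St A, T.stFun τ = p • T.stFun ρ + (1 - p) • T.stFun σ := by
  obtain ⟨q, hq, hq1, hq2⟩ := hT.exists_scalar h0 h1
  obtain ⟨R, hR, rfl⟩ := hT.exists_binary_test ρ
  obtain ⟨R', hR', rfl⟩ := hT.exists_binary_test σ
  obtain ⟨G, -, hS⟩ := hT.exists_coarse_comp hq (F := fun x => if x then R else R')
    (by intro x; cases x <;> simpa)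
  refine ⟨G true, ?_⟩
  ext a
  simp [stFun_apply, (hS true).pair a, hT.pair_scalar_comp, hq1, hq2]

/-- If the preparation of `ρ` fails, then `σ` may be prepared instead. -/
theorem exists_retry {A : C} (ρ σ : T.St A) :
    ∃ τ : T.St A, T.stFun τ = T.stFun ρ + (1 - T.pair (hT.discard A) ρ) • T.stFun σ := by
  obtain ⟨R, hR, rfl⟩ := hT.exists_binary_test ρ
  obtain ⟨R', hR', rfl⟩ := hT.exists_binary_test σ
  obtain ⟨I, hI, hI'⟩ := hT.exists_binary_test (𝟙 A)
  obtain ⟨G, -, hS⟩ := hT.exists_coarse_comp hR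
    (F := fun x => if x then I else fun y => hT.discard A ≫ R' y)
    (by intro x; cases x
        · simpa using hT.channel_comp_test (hT.discard_channel A) hR'
        · simpa)
  have h1 := hT.sum_discard_test hR
  rw [Fintype.sum_bool] at h1
  refine ⟨G true, ?_⟩
  ext a
  have h2 : T.prob (R false ≫ hT.discard A ≫ R' true ≫ a) =
      T.pair (hT.discard A) (R false) * T.pair a (R' true) := by
    rw [← Category.assoc, hT.prob_comp]; rfl
  simp only [stFun_apply, (hS true).pair a, Fintype.sum_bool, Pi.add_apply, Pi.smul_apply,
    smul_eq_mul, if_true, hI', Category.comp_id]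
  congr 1
  rw [← h1, add_sub_cancel_left, ← h2]
  simp [pair]

theorem isClosed_states (A : C) : IsClosed (Set.range (T.stFun (A := A))) := hT.closedStates A

open Filter Topology in
/-- A state may be divided by its norm: this is the limit of preparing it again and again until
the preparation succeeds. -/
theorem exists_normalize {A : C} (ρ : T.St A) (h : 0 < T.pair (hT.discard A) ρ) :
    ∃ τ : T.St A, hT.IsNormalized τ ∧ T.stFun ρ = T.pair (hT.discard A) ρ • T.stFun τ := by
  set t := T.pair (hT.discard A) ρ with ht
  have ht1 : t ≤ 1 := hT.pair_le_one _ _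
  have hk : ∀ n : ℕ, ∃ τ : T.St A,
      T.stFun τ = (∑ k ∈ Finset.range (n + 1), (1 - t) ^ k) • T.stFun ρ := by
    intro n
    induction n with
    | zero => exact ⟨ρ, by simp⟩
    | succ n ih =>
      obtain ⟨σ, hσ⟩ := ih
      obtain ⟨τ, hτ⟩ := hT.exists_retry ρ σ
      refine ⟨τ, ?_⟩
      rw [hτ, hσ, ← ht, Finset.sum_range_succ' _ (n + 1), smul_smul, Finset.mul_sum, add_smul]
      simp only [pow_succ', pow_zero, one_smul]
      rw [add_comm]
  choose σ hσ using hk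
  have hlim : Tendsto (fun n => T.stFun (σ n)) atTop (𝓝 (t⁻¹ • T.stFun ρ)) := by
    simp only [hσ]
    refine Tendsto.smul_const ?_ _
    have h1 := (hasSum_geometric_of_lt_one (r := 1 - t) (by linarith) (by linarith)).tendsto_sum_nat
    rw [sub_sub_cancel] at h1
    exact h1.comp (tendsto_add_atTop_nat 1)
  obtain ⟨τ, hτ⟩ := (hT.isClosed_states A).mem_of_tendsto hlim
    (Eventually.of_forall fun n => ⟨σ n, rfl⟩)
  refine ⟨τ, ?_, ?_⟩
  · unfold IsNormalized
    rw [hτ, Pi.smul_apply, stFun_apply, ← ht, smul_eq_mul, inv_mul_cancel₀ h.ne']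
  · rw [hτ, smul_smul, mul_inv_cancel₀ h.ne', one_smul]

/-- Every element of the cone is a multiple of a normalised state. -/
theorem exists_of_mem_stCone {A : C} {w : T.Eff A → ℝ} (hw : w ∈ T.stCone A) :
    0 ≤ w (hT.discard A) ∧
      ∃ ρ : T.St A, hT.IsNormalized ρ ∧ w = w (hT.discard A) • T.stFun ρ := by
  obtain ⟨c, hc, ρ, rfl⟩ := hw
  refine ⟨mul_nonneg hc (hT.pair_nonneg _ _), ?_⟩
  rcases (hT.pair_nonneg (hT.discard A) ρ).eq_or_lt with h | h
  · obtain ⟨τ, hτ⟩ := hT.exists_normalized A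
    have := hT.stFun_eq_zero h.symm
    exact ⟨τ, hτ, by simp [this]⟩
  · obtain ⟨τ, hτ, h'⟩ := hT.exists_normalize ρ h
    exact ⟨τ, hτ, by rw [Pi.smul_apply, stFun_apply, smul_assoc, ← h']⟩

theorem zero_mem_stCone (A : C) : (0 : T.Eff A → ℝ) ∈ T.stCone A := by
  obtain ⟨ρ, -⟩ := hT.exists_normalized A
  exact ⟨0, le_rfl, ρ, by simp⟩

theorem add_mem_stCone {A : C} {w w' : T.Eff A → ℝ} (hw : w ∈ T.stCone A)
    (hw' : w' ∈ T.stCone A) : w + w' ∈ T.stCone A := by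
  obtain ⟨c, hc, ρ, rfl⟩ := hw
  obtain ⟨d, hd, σ, rfl⟩ := hw'
  rcases (add_nonneg hc hd).eq_or_lt with h | h
  · have h1 : c = 0 := by linarith
    have h2 : d = 0 := by linarith
    simpa [h1, h2] using hT.zero_mem_stCone A
  · obtain ⟨τ, hτ⟩ := hT.exists_mix ρ σ (p := c / (c + d)) (by positivity)
      (by rw [div_le_one h]; linarith)
    refine ⟨c + d, h.le, τ, ?_⟩
    rw [hτ, smul_add, smul_smul, smul_smul]
    congr 2 <;> field_simp
    ring

theorem sum_mem_stCone {A : C} {ι : Type*} (s : Finset ι) {w : ι → T.Eff A → ℝ}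
    (hw : ∀ i ∈ s, w i ∈ T.stCone A) : ∑ i ∈ s, w i ∈ T.stCone A := by
  classical
  induction s using Finset.induction_on with
  | empty => simpa using hT.zero_mem_stCone A
  | insert i s hi ih =>
    rw [Finset.sum_insert hi]
    exact hT.add_mem_stCone (hw i (by simp)) (ih fun j hj => hw j (by simp [hj]))

theorem nonneg_of_mem_stCone {A : C} {w : T.Eff A → ℝ} (hw : w ∈ T.stCone A) (a : T.Eff A) :
    0 ≤ w a := by
  obtain ⟨c, hc, ρ, rfl⟩ := hw
  exact mul_nonneg hc (hT.pair_nonneg _ _)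

theorem le_discard_of_mem_stCone {A : C} {w : T.Eff A → ℝ} (hw : w ∈ T.stCone A) (a : T.Eff A) :
    w a ≤ w (hT.discard A) := by
  obtain ⟨c, hc, ρ, rfl⟩ := hw
  exact mul_le_mul_of_nonneg_left (hT.pair_le_discard _ _) hc

theorem exists_of_mem_stCone_of_eq_one {A : C} {w : T.Eff A → ℝ} (hw : w ∈ T.stCone A)
    (h : w (hT.discard A) = 1) : ∃ ρ : T.St A, hT.IsNormalized ρ ∧ T.stFun ρ = w := by
  obtain ⟨-, ρ, hρ, h'⟩ := hT.exists_of_mem_stCone hw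
  exact ⟨ρ, hρ, by rw [h', h, one_smul]⟩

/-! ### Purity -/

/-- A pure normalised state spans an extreme ray of the cone of states. -/
theorem eq_smul_of_isPure {A : C} {α : T.St A} (hα : T.IsPure α) (hn : hT.IsNormalized α)
    {w w' : T.Eff A → ℝ} (hw : w ∈ T.stCone A) (hw' : w' ∈ T.stCone A)
    (h : T.stFun α = w + w') : w = w (hT.discard A) • T.stFun α := by
  obtain ⟨h0, ρ, hρ, e⟩ := hT.exists_of_mem_stCone hw
  obtain ⟨h0', σ, hσ, e'⟩ := hT.exists_of_mem_stCone hw'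
  have hs : w (hT.discard A) + w' (hT.discard A) = 1 := by
    rw [← Pi.add_apply, ← h]; exact hn
  obtain ⟨q, hq, hq1, hq2⟩ := hT.exists_scalar h0 (by linarith)
  have hD := hT.test_comp_channel hq (g := fun x => if x then ρ else σ) (by
    intro x; cases x
    · exact hT.channel_of_isNormalized hσ
    · exact hT.channel_of_isNormalized hρ)
  obtain ⟨p, -, -, hp⟩ := hα _ Finset.univ hD ⟨true, by simp⟩ (isSum_of_pair fun a => by
    have := congrFun h a
    rw [Pi.add_apply, e, e'] at this
    simp only [Fintype.sum_bool, hT.pair_scalar_comp, hq1, hq2, if_true]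
    rw [← stFun_apply, this, show 1 - w (hT.discard A) = w' (hT.discard A) by linarith]
    simp [stFun_apply])
  have h1 : ∀ a, w a = p true * T.stFun α a := fun a => by
    have := (hp true (by simp)).pair a
    simp only [hT.pair_scalar_comp, hq1, if_true] at this
    rw [stFun_apply, ← this]
    conv_lhs => rw [e]
    rfl
  have h2 : w (hT.discard A) = p true := by
    rw [h1]; unfold IsNormalized at hn; rw [hn, mul_one]
  ext a
  rw [Pi.smul_apply, smul_eq_mul, h2, h1 a]

/-- A normalised state that spans an extreme ray is pure. -/
theorem isPure_of_extreme {A : C} {α : T.St A} (hn : hT.IsNormalized α)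
    (h : ∀ w ∈ T.stCone A, ∀ w' ∈ T.stCone A, T.stFun α = w + w' →
      w = w (hT.discard A) • T.stFun α) : T.IsPure α := by
  classical
  intro Y D s hD hs hS
  refine ⟨fun y => T.pair (hT.discard A) (D y), fun y _ => hT.pair_nonneg _ _, ?_, fun y hy => ?_⟩
  · rw [← hS.pair]; exact hn
  · refine isScale_of_pair fun a => ?_
    have := h (T.stFun (D y)) (stFun_mem_stCone _) (∑ z ∈ s.erase y, T.stFun (D z))
      (hT.sum_mem_stCone _ fun z _ => stFun_mem_stCone _) (by
        rw [Finset.add_sum_erase s (fun z => T.stFun (D z)) hy]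
        ext b
        rw [Finset.sum_apply]
        exact hS.pair b)
    exact congrFun this a

theorem isPure_comp_iso {A B B' : C} {f : A ⟶ B} (hf : T.IsPure f) (W : B ⟶ B') (W' : B' ⟶ B)
    (hW' : T.IsChannel W') (h1 : W ≫ W' = 𝟙 B) (h2 : W' ≫ W = 𝟙 B') : T.IsPure (f ≫ W) := by
  intro Y D s hD hs hS
  obtain ⟨p, hp0, hp1, hp⟩ := hf (fun y => D y ≫ W') s (hT.test_comp_channel hD fun _ => hW') hs
    (by simpa [h1] using hS.postcomp W')
  refine ⟨p, hp0, hp1, fun y hy => ?_⟩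
  simpa [h2] using (hp y hy).comp (𝟙 A) W

theorem isPure_iso_comp {A A' B : C} {f : A ⟶ B} (hf : T.IsPure f) (W : A' ⟶ A) (W' : A ⟶ A')
    (hW' : T.IsChannel W') (h1 : W ≫ W' = 𝟙 A') (h2 : W' ≫ W = 𝟙 A) : T.IsPure (W ≫ f) := by
  intro Y D s hD hs hS
  obtain ⟨p, hp0, hp1, hp⟩ := hf (fun y => W' ≫ D y) s (hT.channel_comp_test hW' hD) hs
    (by simpa [← Category.assoc, h2] using hS.precomp W')
  refine ⟨p, hp0, hp1, fun y hy => ?_⟩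
  have := (hp y hy).comp W (𝟙 B)
  simpa [← Category.assoc, h1] using this

theorem tenE_discard (A B : C) :
    tenE (hT.discard A) (hT.discard B) = hT.discard (A ⊗ B) :=
  hT.eq_discard (hT.channel_comp (hT.channel_tensor (hT.discard_channel A) (hT.discard_channel B))
    (hT.channel_leftUnitor _).1)

theorem isNormalized_condR_discard {A B : C} {Ψ : T.St (A ⊗ B)} (h : hT.IsNormalized Ψ) :
    hT.IsNormalized (condR (hT.discard B) Ψ) := by
  unfold IsNormalized
  rw [stFun_apply, pair_condR, hT.tenE_discard]; exact h

theorem isNormalized_condL_discard {A B : C} {Ψ : T.St (A ⊗ B)} (h : hT.IsNormalized Ψ) :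
    hT.IsNormalized (condL (hT.discard A) Ψ) := by
  unfold IsNormalized
  rw [stFun_apply, pair_condL, hT.tenE_discard]; exact h

theorem exists_purification {A : C} {ρ : T.St A} (h : hT.IsNormalized ρ) :
    ∃ (B : C) (Ψ : T.St (A ⊗ B)), T.IsPure Ψ ∧ hT.IsNormalized Ψ ∧
      condR (hT.discard B) Ψ = ρ := by
  obtain ⟨B, Ψ, h1, h2, e, he, h3⟩ := hT.purification.1 ρ ((hT.isNormalized_iff ρ).1 h)
  exact ⟨B, Ψ, h1, (hT.isNormalized_iff Ψ).2 h2, by rw [← hT.eq_discard he]; exact h3⟩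

theorem exists_reversible_right {A B : C} {Ψ Ψ' : T.St (A ⊗ B)} (hp : T.IsPure Ψ)
    (hn : hT.IsNormalized Ψ) (hp' : T.IsPure Ψ') (hn' : hT.IsNormalized Ψ')
    (h : condR (hT.discard B) Ψ = condR (hT.discard B) Ψ') :
    ∃ U : B ⟶ B, T.IsReversible U ∧ Ψ' = Ψ ≫ A ◁ U :=
  hT.purification.2 (condR (hT.discard B) Ψ) Ψ Ψ'
    ((hT.isNormalized_iff _).1 (hT.isNormalized_condR_discard hn))
    ⟨hp, (hT.isNormalized_iff _).1 hn, _, hT.discard_channel B, rfl⟩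
    ⟨hp', (hT.isNormalized_iff _).1 hn', _, hT.discard_channel B, h.symm⟩

/-- A refinement of the identity acts on each normalised state as a multiplication: it refines a
purification of the state. -/
theorem exists_of_isSum_id {A : C} {Y : Type} {D : Y → (A ⟶ A)} {s : Finset Y} (hD : T.IsTest D)
    (hs : s.Nonempty) (hS : T.IsSum s D (𝟙 A)) {ρ : T.St A} (hρ : hT.IsNormalized ρ) {y : Y}
    (hy : y ∈ s) :
    T.stFun (ρ ≫ D y) = T.pair (hT.discard A) (ρ ≫ D y) • T.stFun ρ := by
  obtain ⟨B, Ψ, hp, hn, rfl⟩ := hT.exists_purification hρ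
  obtain ⟨p, -, -, h⟩ := hp (fun y => Ψ ≫ D y ▷ B) s
    (hT.channel_comp_test (hT.channel_of_isNormalized hn) (hT.test_whiskerRight hD B)) hs
    (by simpa using (hS.whiskerRight B).precomp Ψ)
  have key : ∀ a, T.pair a (condR (hT.discard B) Ψ ≫ D y) =
      p y * T.pair a (condR (hT.discard B) Ψ) := fun a => by
    have := (h y hy).pair (tenE a (hT.discard B))
    rwa [pair_tenE_whiskerRight, ← pair_condR, ← pair_condR, ← pair_comp] at this
  have hn1 : T.pair (hT.discard A) (condR (hT.discard B) Ψ) = 1 := hρ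
  ext a
  rw [Pi.smul_apply, stFun_apply, stFun_apply, key a, key (hT.discard A), hn1, mul_one, smul_eq_mul]

/-- The identity is pure: there is no information without disturbance.  The multiplier by which a
refinement of the identity acts on a state does not depend on the state, as a comparison of two
states with their average shows. -/
theorem isPure_id (A : C) : T.IsPure (𝟙 A) := by
  intro Y D s hD hs hS
  obtain ⟨ρ₀, hρ₀⟩ := hT.exists_normalized A
  have hadd : ∀ {ρ σ : T.St A}, hT.IsNormalized ρ → hT.IsNormalized σ → ∀ y ∈ s,
      T.pair (hT.discard A) (ρ ≫ D y) = T.pair (hT.discard A) (σ ≫ D y) := by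
    intro ρ σ hρ hσ y hy
    obtain ⟨τ, hτ⟩ := hT.exists_mix ρ σ (p := 1 / 2) (by norm_num) (by norm_num)
    have hτn : hT.IsNormalized τ := by
      unfold IsNormalized at *
      rw [hτ, Pi.add_apply, Pi.smul_apply, Pi.smul_apply, hρ, hσ]
      norm_num
    have h1 := fun a => congrFun (hT.exists_of_isSum_id hD hs hS hρ hy) a
    have h2 := fun a => congrFun (hT.exists_of_isSum_id hD hs hS hσ hy) a
    have h3 := fun a => congrFun (hT.exists_of_isSum_id hD hs hS hτn hy) a
    have h4 : ∀ a, T.pair a (τ ≫ D y) =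
        1 / 2 * T.pair a (ρ ≫ D y) + (1 - 1 / 2) * T.pair a (σ ≫ D y) := fun a => by
      have := congrFun hτ (D y ≫ a)
      simpa [stFun_apply, pair_comp] using this
    by_cases hne : T.stFun ρ = T.stFun σ
    · rw [hT.st_ext hne]
    obtain ⟨a, ha⟩ := Function.ne_iff.1 hne
    have h5 := congrFun hτ a
    have h1a := h1 a
    have h2a := h2 a
    have h3a := h3 a
    have h4u := h4 (hT.discard A)
    have h4a := h4 a
    simp only [Pi.smul_apply, Pi.add_apply, smul_eq_mul, stFun_apply] at *
    rw [h1a, h2a, h3a, h5, h4u] at h4a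
    have : (T.pair (hT.discard A) (ρ ≫ D y) - T.pair (hT.discard A) (σ ≫ D y)) *
        (T.pair a ρ - T.pair a σ) = 0 := by linear_combination (-4) * h4a
    rcases mul_eq_zero.1 this with h | h
    · linarith
    · exact absurd (by linarith) ha
  refine ⟨fun y => T.pair (hT.discard A) (ρ₀ ≫ D y), fun y _ => hT.pair_nonneg _ _, ?_, ?_⟩
  · have h1 := (hS.precomp ρ₀).pair (hT.discard A)
    rw [← h1, Category.comp_id]; exact hρ₀
  · intro y hy S ρ a
    -- The refinement acts on `A ⊗ S` as multiplication by a number that depends on the marginal.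
    have main : ∀ σ : T.St (A ⊗ S), hT.IsNormalized σ → ∀ a, T.pair a (σ ≫ D y ▷ S) =
        T.pair (hT.discard A) (ρ₀ ≫ D y) * T.pair a σ := by
      intro σ hσ a
      have h1 := hT.exists_of_isSum_id (hT.test_whiskerRight hD S) hs
        (by simpa using hS.whiskerRight S) hσ hy
      have h2 : T.pair (hT.discard (A ⊗ S)) (σ ≫ D y ▷ S) =
          T.pair (hT.discard A) (ρ₀ ≫ D y) := by
        rw [← hT.tenE_discard, pair_tenE_whiskerRight, ← pair_condR, ← pair_comp]
        exact hadd (hT.isNormalized_condR_discard hσ) hρ₀ y hy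
      rw [h2] at h1
      exact congrFun h1 a
    obtain ⟨-, σ, hσ, e⟩ := hT.exists_of_mem_stCone (stFun_mem_stCone ρ)
    have h1 : T.circ (D y) S ρ a = T.stFun ρ (D y ▷ S ≫ a) := by simp [circ, stFun_apply, pair]
    have h2 : T.circ (𝟙 A) S ρ a = T.stFun ρ a := by simp [circ, stFun_apply, pair]
    have h3 := main σ hσ a
    rw [pair_comp] at h3
    rw [h1, h2, e]
    simp only [Pi.smul_apply, smul_eq_mul, stFun_apply, h3]
    ring

theorem isPure_condL {A B : C} {a : T.Eff A} {Ψ : T.St (A ⊗ B)} (ha : T.IsPure a)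
    (hΨ : T.IsPure Ψ) : T.IsPure (condL a Ψ) := by
  have h : T.IsPure (Ψ ≫ a ▷ B) := by
    rw [← tensorHom_id]
    exact hT.purityPreservation.1 _ _ hΨ (hT.purityPreservation.2 _ _ ha (hT.isPure_id B))
  unfold condL
  rw [← Category.assoc]
  intro Y
  exact hT.isPure_comp_iso h (λ_ B).hom (λ_ B).inv (hT.channel_leftUnitor B).2 (by simp) (by simp)

theorem isPure_condR {A B : C} {b : T.Eff B} {Ψ : T.St (A ⊗ B)} (hb : T.IsPure b)
    (hΨ : T.IsPure Ψ) : T.IsPure (condR b Ψ) := by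
  have h : T.IsPure (Ψ ≫ A ◁ b) := by
    rw [← id_tensorHom]
    exact hT.purityPreservation.1 _ _ hΨ (hT.purityPreservation.2 _ _ (hT.isPure_id A) hb)
  unfold condR
  rw [← Category.assoc]
  intro Y
  exact hT.isPure_comp_iso h (ρ_ A).hom (ρ_ A).inv (hT.channel_rightUnitor A).2 (by simp) (by simp)

theorem isPure_tenE {A B : C} {a : T.Eff A} {b : T.Eff B} (ha : T.IsPure a) (hb : T.IsPure b) :
    T.IsPure (tenE a b) :=
  hT.isPure_comp_iso (hT.purityPreservation.2 _ _ ha hb) _ (λ_ (𝟙_ C)).inv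
    (hT.channel_leftUnitor _).2 (by simp) (by simp)

theorem isPure_tenS {A B : C} {ρ : T.St A} {σ : T.St B} (hρ : T.IsPure ρ) (hσ : T.IsPure σ) :
    T.IsPure (tenS ρ σ) :=
  hT.isPure_iso_comp (hT.purityPreservation.2 _ _ hρ hσ) _ (λ_ (𝟙_ C)).hom
    (hT.channel_leftUnitor _).1 (by simp) (by simp)

theorem pair_tenE_tenS {A B : C} (a : T.Eff A) (b : T.Eff B) (ρ : T.St A) (σ : T.St B) :
    T.pair (tenE a b) (tenS ρ σ) = T.pair a ρ * T.pair b σ := by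
  have h : tenS ρ σ ≫ tenE a b = (ρ ≫ a) ≫ (σ ≫ b) := by
    simp only [tenS, tenE, Category.assoc, tensorHom_comp_tensorHom_assoc]
    rw [MonoidalCategory.tensorHom_def]
    simp only [Category.assoc, leftUnitor_naturality]
    rw [unitors_equal, rightUnitor_naturality_assoc, unitors_inv_equal]
    simp
  unfold pair
  rw [h, hT.prob_comp]

theorem isNormalized_tenS {A B : C} {ρ : T.St A} {σ : T.St B} (hρ : hT.IsNormalized ρ)
    (hσ : hT.IsNormalized σ) : hT.IsNormalized (tenS ρ σ) := by
  unfold IsNormalized at *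
  rw [stFun_apply] at *
  rw [← hT.tenE_discard, hT.pair_tenE_tenS, hρ, hσ, one_mul]

end IsSharpWithPurification
end OPTData

/-! ### Symmetric convex bodies -/

section ConvexBodies

open Set

/-- The invertible linear maps of `V` that preserve `N`, together with their inverses. -/
def autPairs {V : Type*} [NormedAddCommGroup V] [NormedSpace ℝ V] (N : Set V) :
    Set ((V →L[ℝ] V) × (V →L[ℝ] V)) :=
  {p | p.1 ∘L p.2 = .id ℝ V ∧ p.2 ∘L p.1 = .id ℝ V ∧ MapsTo p.1 N N ∧ MapsTo p.2 N N}

theorem mem_extremePoints_of_mem_autPairs {V : Type*} [NormedAddCommGroup V] [NormedSpace ℝ V]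
    {N : Set V} {p : (V →L[ℝ] V) × (V →L[ℝ] V)} (hp : p ∈ autPairs N)
    {x : V} (hx : x ∈ N.extremePoints ℝ) : p.1 x ∈ N.extremePoints ℝ := by
  obtain ⟨h1, h2, h3, h4⟩ := hp
  have e1 : ∀ y, p.1 (p.2 y) = y := fun y => congrArg (fun L : V →L[ℝ] V => L y) h1
  have e2 : ∀ y, p.2 (p.1 y) = y := fun y => congrArg (fun L : V →L[ℝ] V => L y) h2
  refine ⟨h3 hx.1, fun y hy z hz hyz => ?_⟩
  obtain ⟨a, b, ha, hb, hab, h⟩ := hyz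
  have : p.2 y = x := hx.2 (h4 hy) (h4 hz) ⟨a, b, ha, hb, hab, by
    rw [← map_smul, ← map_smul, ← map_add, h, e2]⟩
  rw [← this, e1]

variable {V : Type*} [NormedAddCommGroup V] [InnerProductSpace ℝ V] [FiniteDimensional ℝ V]
  {N : Set V}

/-- The automorphisms of a compact spanning set are uniformly bounded, so their group is compact.
Pairing each with its inverse makes invertibility a closed condition. -/
theorem isCompact_autPairs (hN : IsCompact N) (hs : Submodule.span ℝ N = ⊤) :
    IsCompact (autPairs N) := by
  have hbd : ∀ x : V, ∃ c : ℝ, ∀ L : V →L[ℝ] V, MapsTo L N N → ‖L x‖ ≤ c := by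
    intro x
    have hx : x ∈ Submodule.span ℝ N := by rw [hs]; trivial
    induction hx using Submodule.span_induction with
    | mem x h =>
      obtain ⟨c, hc⟩ := hN.isBounded.exists_norm_le
      exact ⟨c, fun L hL => hc _ (hL h)⟩
    | zero => exact ⟨0, fun L _ => by simp⟩
    | add x y _ _ hx hy =>
      obtain ⟨c, hc⟩ := hx
      obtain ⟨d, hd⟩ := hy
      exact ⟨c + d, fun L hL => by
        rw [map_add]; exact (norm_add_le _ _).trans (add_le_add (hc L hL) (hd L hL))⟩
    | smul r x _ hx =>
      obtain ⟨c, hc⟩ := hx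
      exact ⟨‖r‖ * c, fun L hL => by
        rw [map_smul, norm_smul]; exact mul_le_mul_of_nonneg_left (hc L hL) (norm_nonneg r)⟩
  obtain ⟨c, hc⟩ := banach_steinhaus (g := fun L : {L : V →L[ℝ] V // MapsTo L N N} => L.1)
    (fun x => (hbd x).imp fun c hc L => hc L.1 L.2)
  refine Metric.isCompact_of_isClosed_isBounded ?_ ?_
  · have h1 : IsClosed {p : (V →L[ℝ] V) × (V →L[ℝ] V) | p.1 ∘L p.2 = .id ℝ V} :=
      isClosed_eq (by fun_prop) continuous_const
    have h2 : IsClosed {p : (V →L[ℝ] V) × (V →L[ℝ] V) | p.2 ∘L p.1 = .id ℝ V} :=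
      isClosed_eq (by fun_prop) continuous_const
    have h3 : IsClosed {p : (V →L[ℝ] V) × (V →L[ℝ] V) | MapsTo p.1 N N} := by
      simp only [MapsTo, ofPred_forall]
      exact isClosed_iInter fun x => isClosed_iInter fun _ => hN.isClosed.preimage (by fun_prop)
    have h4 : IsClosed {p : (V →L[ℝ] V) × (V →L[ℝ] V) | MapsTo p.2 N N} := by
      simp only [MapsTo, ofPred_forall]
      exact isClosed_iInter fun x => isClosed_iInter fun _ => hN.isClosed.preimage (by fun_prop)
    exact (h1.inter (h2.inter (h3.inter h4)))
  · refine isBounded_iff_forall_norm_le.2 ⟨c, fun p hp => ?_⟩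
    exact max_le (hc ⟨p.1, hp.2.2.1⟩) (hc ⟨p.2, hp.2.2.2⟩)

/-- If the automorphisms of a convex body act transitively on its extreme points, then the
extreme points form an orbit of a compact group. -/
theorem isCompact_extremePoints_of_transitive (hN : IsCompact N) (hs : Submodule.span ℝ N = ⊤)
    (htr : ∀ x ∈ N.extremePoints ℝ, ∀ y ∈ N.extremePoints ℝ, ∃ p ∈ autPairs N, p.1 x = y) :
    IsCompact (N.extremePoints ℝ) := by
  rcases (N.extremePoints ℝ).eq_empty_or_nonempty with h | ⟨x, hx⟩
  · rw [h]; exact isCompact_empty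
  have : N.extremePoints ℝ = (fun p : (V →L[ℝ] V) × (V →L[ℝ] V) => p.1 x) '' autPairs N := by
    ext y
    constructor
    · intro hy; exact htr x hx y hy
    · rintro ⟨p, hp, rfl⟩; exact mem_extremePoints_of_mem_autPairs hp hx
  rw [this]
  exact (isCompact_autPairs hN hs).image (by fun_prop)

/-- The point minimising the largest norm along its orbit is a fixed point: in a Euclidean space
the midpoint of two distinct vectors of equal norm is shorter. -/
theorem exists_fixed_of_autPairs (hN : IsCompact N) (hc : Convex ℝ N) (hne : N.Nonempty)
    (hs : Submodule.span ℝ N = ⊤) : ∃ x ∈ N, ∀ p ∈ autPairs N, p.1 x = x := by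
  have hK := isCompact_autPairs hN hs
  set g : V → ℝ := fun x => sSup ((fun p : (V →L[ℝ] V) × (V →L[ℝ] V) => ‖p.1 x‖) '' autPairs N)
    with hg
  have hcont : ∀ x, Continuous fun p : (V →L[ℝ] V) × (V →L[ℝ] V) => ‖p.1 x‖ := fun x => by fun_prop
  have hgc : Continuous g := hK.continuous_sSup (f := fun x p => ‖p.1 x‖) (by
    change Continuous fun q : V × ((V →L[ℝ] V) × (V →L[ℝ] V)) => ‖q.2.1 q.1‖
    fun_prop)
  have hK0 : (autPairs N).Nonempty :=
    ⟨(.id ℝ V, .id ℝ V), by simp [autPairs, MapsTo]⟩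
  have hle : ∀ x, ∀ p ∈ autPairs N, ‖p.1 x‖ ≤ g x := fun x p hp =>
    le_csSup (hK.image (hcont x)).bddAbove ⟨p, hp, rfl⟩
  obtain ⟨x, hx, hmin⟩ := hN.exists_isMinOn hne hgc.continuousOn
  refine ⟨x, hx, fun p hp => ?_⟩
  by_contra hne'
  have hpx : p.1 x ∈ N := hp.2.2.1 hx
  have hm : midpoint ℝ x (p.1 x) ∈ N := hc.segment_subset hx hpx (midpoint_mem_segment _ _)
  obtain ⟨q, hq, hqe⟩ := hK.exists_sSup_image_eq hK0 (hcont (midpoint ℝ x (p.1 x))).continuousOn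
  have hqp : (q.1 ∘L p.1, p.2 ∘L q.2) ∈ autPairs N := by
    obtain ⟨h1, h2, h3, h4⟩ := hp
    obtain ⟨k1, k2, k3, k4⟩ := hq
    refine ⟨?_, ?_, k3.comp h3, h4.comp k4⟩
    · calc _ = q.1 ∘L (p.1 ∘L p.2) ∘L q.2 := rfl
        _ = _ := by rw [h1]; simpa using k1
    · calc _ = p.2 ∘L (q.2 ∘L q.1) ∘L p.1 := rfl
        _ = _ := by rw [k2]; simpa using h2
  have h1 : ‖q.1 x‖ ≤ g x := hle x q hq
  have h2 : ‖q.1 (p.1 x)‖ ≤ g x := hle x _ hqp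
  have hqinj : q.1 x ≠ q.1 (p.1 x) := fun h => hne' (by
    have e := congrArg q.2 h
    have e2 : ∀ y, q.2 (q.1 y) = y := fun y => congrArg (fun L : V →L[ℝ] V => L y) hq.2.1
    rw [e2, e2] at e
    exact e.symm)
  have h3 : ‖(1 / 2 : ℝ) • q.1 x + (1 / 2 : ℝ) • q.1 (p.1 x)‖ < g x :=
    norm_combo_lt_of_ne h1 h2 hqinj (by norm_num) (by norm_num) (by norm_num)
  have h4 : q.1 (midpoint ℝ x (p.1 x)) = (1 / 2 : ℝ) • q.1 x + (1 / 2 : ℝ) • q.1 (p.1 x) := by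
    rw [midpoint_eq_smul_add, map_smul, map_add, smul_add]; norm_num
  have h5 : g (midpoint ℝ x (p.1 x)) < g x := by
    rw [hg]; dsimp only; rw [hqe, h4]; exact h3
  exact absurd (hmin hm) (not_le.2 h5)

/-- In finite dimension, every point of a convex body whose extreme points form a compact set has
an extreme component of weight bounded below. -/
theorem exists_extreme_component (hN : IsCompact N) (hc : Convex ℝ N)
    (he : IsCompact (N.extremePoints ℝ)) : ∃ c : ℝ, 0 < c ∧ ∀ x ∈ N,
      ∃ w ∈ Icc c 1, ∃ y ∈ N.extremePoints ℝ, ∃ z ∈ N, x = w • y + (1 - w) • z := by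
  set d : ℝ := ((Module.finrank ℝ V + 1 : ℕ) : ℝ) with hd
  have hd0 : 0 < d := by rw [hd]; positivity
  refine ⟨d⁻¹, by positivity, ?_⟩
  set S : Set V := (fun q : ℝ × V × V => q.1 • q.2.1 + (1 - q.1) • q.2.2) ''
    (Icc d⁻¹ 1 ×ˢ (N.extremePoints ℝ) ×ˢ N) with hS
  have hSc : IsClosed S :=
    ((isCompact_Icc.prod (he.prod hN)).image (by fun_prop)).isClosed
  have hsub : convexHull ℝ (N.extremePoints ℝ) ⊆ S := by
    intro x hx
    obtain ⟨ι, _, z, w, hz, haff, hw, hw1, rfl⟩ := eq_pos_convex_span_of_mem_convexHull hx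
    classical
    have hcard : (Fintype.card ι : ℝ) ≤ d := by
      rw [hd]; exact_mod_cast haff.card_le_finrank_succ.trans
        (Nat.succ_le_succ (Submodule.finrank_le _))
    obtain ⟨i, hi⟩ : ∃ i, d⁻¹ ≤ w i := by
      by_contra! h
      have hne : (Finset.univ : Finset ι).Nonempty := by
        rw [Finset.nonempty_iff_ne_empty]; intro h0; rw [h0] at hw1; simp at hw1
      have h1 : ∑ i, w i < ∑ _i : ι, d⁻¹ := Finset.sum_lt_sum_of_nonempty hne fun i _ => h i
      rw [hw1, Finset.sum_const, Finset.card_univ, nsmul_eq_mul] at h1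
      have : (Fintype.card ι : ℝ) * d⁻¹ ≤ 1 := by
        rw [← div_eq_mul_inv, div_le_one hd0]; exact hcard
      linarith
    have hzN : ∀ j, z j ∈ N := fun j => (hz ⟨j, rfl⟩).1
    have hi1 : w i ≤ 1 := by
      rw [← hw1]; exact Finset.single_le_sum (fun j _ => (hw j).le) (Finset.mem_univ i)
    have hsum : ∑ j ∈ Finset.univ.erase i, w j = 1 - w i := by
      rw [← hw1, ← Finset.add_sum_erase _ _ (Finset.mem_univ i)]; ring
    rcases hi1.eq_or_lt with h1 | h1
    · refine ⟨(w i, z i, z i), ⟨⟨hi, hi1⟩, hz ⟨i, rfl⟩, hzN i⟩, ?_⟩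
      dsimp only
      rw [h1, sub_self, zero_smul, ← Finset.add_sum_erase _ _ (Finset.mem_univ i), h1]
      congr 1
      symm
      refine Finset.sum_eq_zero fun j hj => ?_
      have := (Finset.sum_eq_zero_iff_of_nonneg (fun j _ => (hw j).le)).1
        (hsum.trans (by rw [h1, sub_self])) j hj
      rw [this, zero_smul]
    · refine ⟨(w i, z i, (1 - w i)⁻¹ • ∑ j ∈ Finset.univ.erase i, w j • z j),
        ⟨⟨hi, hi1⟩, hz ⟨i, rfl⟩, ?_⟩, ?_⟩
      · have h2 : 0 < 1 - w i := by linarith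
        dsimp only
        rw [Finset.smul_sum]
        simp only [smul_smul]
        refine hc.sum_mem (fun j _ => mul_nonneg (inv_nonneg.2 h2.le) (hw j).le) ?_
          fun j _ => hzN j
        rw [← Finset.mul_sum, hsum, inv_mul_cancel₀ h2.ne']
      · have h2 : 1 - w i ≠ 0 := by linarith
        dsimp only
        rw [smul_smul, mul_inv_cancel₀ h2, one_smul,
          Finset.add_sum_erase _ (fun j => w j • z j) (Finset.mem_univ i)]
  intro x hx
  rw [← closure_convexHull_extremePoints hN hc] at hx
  obtain ⟨q, hq, rfl⟩ := closure_minimal hsub hSc hx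
  exact ⟨q.1, hq.1, q.2.1, hq.2.1, q.2.2, hq.2.2, rfl⟩

end ConvexBodies

namespace OPTData

variable {C : Type u} [Category.{v} C] [MonoidalCategory C] [SymmetricCategory C] {T : OPTData C}

namespace IsSharpWithPurification

variable (hT : T.IsSharpWithPurification)

/-! ### The convex body of normalised states -/

/-- The normalised states of `A`, as families of probabilities. -/
def body (A : C) : Set (T.Eff A → ℝ) := {w | ∃ ρ : T.St A, hT.IsNormalized ρ ∧ T.stFun ρ = w}

/-- Normalised pure states. -/
def IsPureState {A : C} (α : T.St A) : Prop := T.IsPure α ∧ hT.IsNormalized α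

include hT

theorem isCompact_range_stFun (A : C) : IsCompact (Set.range (T.stFun (A := A))) := by
  refine (isCompact_univ_pi fun _ : T.Eff A =>
    isCompact_Icc (a := (0 : ℝ)) (b := 1)).of_isClosed_subset (hT.isClosed_states A) ?_
  rintro _ ⟨ρ, rfl⟩ a -
  exact hT.prob_mem _

theorem isCompact_body (A : C) : IsCompact (hT.body A) := by
  have h : hT.body A = Set.range (T.stFun (A := A)) ∩ {w | w (hT.discard A) = 1} := by
    ext w
    constructor
    · rintro ⟨ρ, hρ, rfl⟩; exact ⟨⟨ρ, rfl⟩, hρ⟩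
    · rintro ⟨⟨ρ, rfl⟩, hρ⟩; exact ⟨ρ, hρ, rfl⟩
  rw [h]
  exact (hT.isCompact_range_stFun A).inter_right
    (isClosed_eq (continuous_apply _) continuous_const)

theorem convex_body (A : C) : Convex ℝ (hT.body A) := by
  rintro _ ⟨ρ, hρ, rfl⟩ _ ⟨σ, hσ, rfl⟩ a b ha hb hab
  refine hT.exists_of_mem_stCone_of_eq_one
    (hT.add_mem_stCone ⟨a, ha, ρ, rfl⟩ ⟨b, hb, σ, rfl⟩) ?_
  unfold IsNormalized at hρ hσ
  simp [hρ, hσ, hab]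

theorem body_nonempty (A : C) : (hT.body A).Nonempty := by
  obtain ⟨ρ, hρ⟩ := hT.exists_normalized A
  exact ⟨_, ρ, hρ, rfl⟩

theorem extremePoints_body (A : C) :
    (hT.body A).extremePoints ℝ = {w | ∃ α, hT.IsPureState α ∧ T.stFun α = w} := by
  ext w
  constructor
  · rintro ⟨⟨α, hα, rfl⟩, hext⟩
    refine ⟨α, ⟨hT.isPure_of_extreme hα fun w hw w' hw' h => ?_, hα⟩, rfl⟩
    obtain ⟨h0, ρ, hρ, e⟩ := hT.exists_of_mem_stCone hw
    obtain ⟨h0', σ, hσ, e'⟩ := hT.exists_of_mem_stCone hw'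
    have hs : w (hT.discard A) + w' (hT.discard A) = 1 := by
      rw [← Pi.add_apply, ← h]; exact hα
    rcases h0.eq_or_lt with h1 | h1
    · conv_lhs => rw [e]
      rw [← h1, zero_smul, zero_smul]
    rcases h0'.eq_or_lt with h1' | h1'
    · have : w' = 0 := by rw [e', ← h1', zero_smul]
      rw [this, add_zero] at h
      have : w (hT.discard A) = 1 := by linarith
      rw [this, one_smul, h]
    · have := hext ⟨ρ, hρ, rfl⟩ ⟨σ, hσ, rfl⟩ ⟨_, _, h1, h1', hs, by rw [← e, ← e', h]⟩
      rw [← this]; exact e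
  · rintro ⟨α, ⟨hα, hn⟩, rfl⟩
    refine ⟨⟨α, hn, rfl⟩, ?_⟩
    rintro _ ⟨ρ, hρ, rfl⟩ _ ⟨σ, hσ, rfl⟩ ⟨a, b, ha, hb, hab, h⟩
    have := hT.eq_smul_of_isPure hα hn ⟨a, ha.le, ρ, rfl⟩ ⟨b, hb.le, σ, rfl⟩ h.symm
    unfold IsNormalized at hρ
    rw [Pi.smul_apply, hρ, smul_eq_mul, mul_one] at this
    exact smul_right_injective _ ha.ne' this

theorem exists_isPureState (A : C) : ∃ α : T.St A, hT.IsPureState α := by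
  obtain ⟨w, hw⟩ := (hT.isCompact_body A).extremePoints_nonempty (hT.body_nonempty A)
  rw [hT.extremePoints_body] at hw
  obtain ⟨α, hα, -⟩ := hw
  exact ⟨α, hα⟩

/-- A closed convex condition that holds for all normalised pure states holds for all
normalised states. -/
theorem mem_of_forall_isPureState {A : C} {K : Set (T.Eff A → ℝ)} (hK : IsClosed K)
    (hK' : Convex ℝ K) (h : ∀ α : T.St A, hT.IsPureState α → T.stFun α ∈ K) {ρ : T.St A}
    (hρ : hT.IsNormalized ρ) : T.stFun ρ ∈ K := by
  have h1 : T.stFun ρ ∈ hT.body A := ⟨ρ, hρ, rfl⟩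
  rw [← closure_convexHull_extremePoints (hT.isCompact_body A) (hT.convex_body A),
    hT.extremePoints_body] at h1
  refine closure_minimal (convexHull_min ?_ hK') hK h1
  rintro _ ⟨α, hα, rfl⟩
  exact h α hα

theorem isPureState_comp {A : C} {α : T.St A} (hα : hT.IsPureState α) {U : A ⟶ A}
    (hU : T.IsReversible U) : hT.IsPureState (α ≫ U) := by
  obtain ⟨hc, V, hV, h1, h2⟩ := hU
  exact ⟨hT.isPure_comp_iso hα.1 U V hV h1 h2, hT.isNormalized_comp hα.2 hc⟩

theorem prob_eq_one {s : T.St (𝟙_ C)} (h : hT.IsNormalized s) : T.prob s = 1 := by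
  have h1 : T.prob (s ≫ hT.discard _) = 1 := h
  rwa [hT.prob_comp, hT.prob_channel (hT.discard_channel _), mul_one] at h1

/-- The reversible channels act transitively on normalised pure states, since these are the
purifications of the unique normalised state of the trivial system. -/
theorem exists_reversible_of_isPureState {A : C} {α β : T.St A} (hα : hT.IsPureState α)
    (hβ : hT.IsPureState β) : ∃ U : A ⟶ A, T.IsReversible U ∧ β = α ≫ U := by
  have hp : ∀ {γ : T.St A}, hT.IsPureState γ → T.IsPure (γ ≫ (λ_ A).inv) := fun hγ =>
    hT.isPure_comp_iso hγ.1 _ (λ_ A).hom (hT.channel_leftUnitor A).1 (by simp) (by simp)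
  have hn : ∀ {γ : T.St A}, hT.IsPureState γ → hT.IsNormalized (γ ≫ (λ_ A).inv) := fun hγ =>
    hT.isNormalized_comp hγ.2 (hT.channel_leftUnitor A).2
  obtain ⟨U, hU, h⟩ := hT.exists_reversible_right (hp hα) (hn hα) (hp hβ) (hn hβ)
    (hT.scalar_ext (by
      rw [hT.prob_eq_one (hT.isNormalized_condR_discard (hn hα)),
        hT.prob_eq_one (hT.isNormalized_condR_discard (hn hβ))]))
  refine ⟨U, hU, ?_⟩
  rw [Category.assoc, ← leftUnitor_inv_naturality, ← Category.assoc] at h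
  exact (cancel_mono _).1 h

theorem isPureState_braiding {A B : C} {Ψ : T.St (A ⊗ B)} (h : hT.IsPureState Ψ) :
    hT.IsPureState (Ψ ≫ (β_ A B).hom) :=
  ⟨hT.isPure_comp_iso h.1 _ (β_ B A).hom (hT.channel_braiding B A) (by simp) (by simp),
    hT.isNormalized_comp h.2 (hT.channel_braiding A B)⟩

/-- Uniqueness of purification, for a purifying system on the left. -/
theorem exists_reversible_left {A B : C} {Ψ Ψ' : T.St (A ⊗ B)} (hΨ : hT.IsPureState Ψ)
    (hΨ' : hT.IsPureState Ψ') (h : condL (hT.discard A) Ψ = condL (hT.discard A) Ψ') :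
    ∃ U : A ⟶ A, T.IsReversible U ∧ Ψ' = Ψ ≫ U ▷ B := by
  have h1 := hT.isPureState_braiding hΨ
  have h2 := hT.isPureState_braiding hΨ'
  obtain ⟨U, hU, e⟩ := hT.exists_reversible_right h1.1 h1.2 h2.1 h2.2 (hT.st_ext (by
    ext b
    simp only [stFun_apply, pair_condR, pair_tenE_braiding]
    rw [← pair_condL, ← pair_condL, h]))
  refine ⟨U, hU, ?_⟩
  rw [Category.assoc, ← BraidedCategory.braiding_naturality_left, ← Category.assoc] at e
  exact (cancel_mono _).1 e

/-! ### Pure effects and the states on which they occur with certainty -/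

omit hT in
theorem pair_condL' {A B : C} (a : T.Eff A) (b : T.Eff B) (Ψ : T.St (A ⊗ B)) :
    T.pair b (condL a Ψ) = T.pair a (condR b Ψ) := by rw [pair_condL, pair_condR]

theorem isNormalized_of_pair_eq_one {A : C} {a : T.Eff A} {ρ : T.St A} (h : T.pair a ρ = 1) :
    hT.IsNormalized ρ :=
  le_antisymm (hT.pair_le_one _ _) (h ▸ hT.pair_le_discard a ρ)

/-- A pure effect occurs with certainty only on pure states: applied to one half of a
purification of `ρ`, it leaves the other half in a pure state, which must be the marginal. -/
theorem isPureState_of_pair_eq_one {A : C} {a : T.Eff A} (ha : T.IsPure a) {ρ : T.St A}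
    (h : T.pair a ρ = 1) : hT.IsPureState ρ := by
  obtain ⟨B, Ψ, hp, hn, rfl⟩ := hT.exists_purification (hT.isNormalized_of_pair_eq_one h)
  have hmarg : condL a Ψ = condL (hT.discard A) Ψ := by
    refine hT.st_ext ?_
    ext b
    obtain ⟨b', hb'⟩ := hT.exists_compl b
    have e1 := hb' (condL a Ψ)
    have e2 := hb' (condL (hT.discard A) Ψ)
    rw [pair_condL' a (hT.discard B), h] at e1
    have e3 : T.pair (hT.discard B) (condL (hT.discard A) Ψ) = 1 :=
      hT.isNormalized_condL_discard hn
    have l1 := hT.pair_le_discard a (condR b Ψ)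
    have l2 := hT.pair_le_discard a (condR b' Ψ)
    rw [← pair_condL', ← pair_condL'] at l1 l2
    simp only [stFun_apply]
    linarith
  obtain ⟨α₀, hα₀⟩ := hT.exists_isPureState A
  have hβ : hT.IsPureState (condL a Ψ) :=
    ⟨hT.isPure_condL ha hp, hmarg ▸ hT.isNormalized_condL_discard hn⟩
  obtain ⟨U, hU, e⟩ := hT.exists_reversible_left
    (Ψ := tenS α₀ (condL a Ψ)) (Ψ' := Ψ)
    ⟨hT.isPure_tenS hα₀.1 hβ.1, hT.isNormalized_tenS hα₀.2 hβ.2⟩ ⟨hp, hn⟩ (hT.st_ext (by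
      ext b
      have h0 : T.pair (hT.discard A) α₀ = 1 := hα₀.2
      simp only [stFun_apply]
      rw [pair_condL, hT.pair_tenE_tenS, h0, one_mul, hmarg]))
  have hρ : condR (hT.discard B) Ψ = α₀ ≫ U := by
    refine hT.st_ext ?_
    ext a'
    have h0 : T.pair (hT.discard B) (condL a Ψ) = 1 := hβ.2
    simp only [stFun_apply]
    conv_lhs => rw [e]
    rw [pair_condR, pair_tenE_whiskerRight, hT.pair_tenE_tenS, h0, mul_one, pair_comp]
  rw [hρ]
  exact hT.isPureState_comp hα₀ hU

theorem exists_avg {A : C} {ρ σ : T.St A} (hρ : hT.IsNormalized ρ) (hσ : hT.IsNormalized σ) :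
    ∃ τ : T.St A, hT.IsNormalized τ ∧
      T.stFun τ = (1 / 2 : ℝ) • T.stFun ρ + (1 / 2 : ℝ) • T.stFun σ := by
  obtain ⟨τ, hτ, e⟩ := hT.convex_body A ⟨ρ, hρ, rfl⟩ ⟨σ, hσ, rfl⟩ (a := 1 / 2) (b := 1 / 2)
    (by norm_num) (by norm_num) (by norm_num)
  exact ⟨τ, hτ, e⟩

/-- A pure state is an average only of itself. -/
theorem eq_of_avg {A : C} {α ρ σ : T.St A} (hα : hT.IsPureState α) (hρ : hT.IsNormalized ρ)
    (h : T.stFun α = (1 / 2 : ℝ) • T.stFun ρ + (1 / 2 : ℝ) • T.stFun σ) : ρ = α := by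
  have h1 := hT.eq_smul_of_isPure hα.1 hα.2 ⟨1 / 2, by norm_num, ρ, rfl⟩
    ⟨1 / 2, by norm_num, σ, rfl⟩ h
  unfold IsNormalized at hρ
  rw [Pi.smul_apply, hρ, smul_eq_mul, mul_one] at h1
  exact hT.st_ext (smul_right_injective _ (by norm_num : (1 / 2 : ℝ) ≠ 0) h1)

/-- A pure effect occurs with certainty on at most one state, since it would occur with certainty on
the average of two, which would be pure. -/
theorem eq_of_pair_eq_one {A : C} {a : T.Eff A} (ha : T.IsPure a) {ρ σ : T.St A}
    (hρ : T.pair a ρ = 1) (hσ : T.pair a σ = 1) : ρ = σ := by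
  have hρ' := hT.isNormalized_of_pair_eq_one hρ
  have hσ' := hT.isNormalized_of_pair_eq_one hσ
  obtain ⟨τ, -, hτ⟩ := hT.exists_avg hρ' hσ'
  have h : T.pair a τ = 1 := by
    have := congrFun hτ a
    simp only [stFun_apply, Pi.add_apply, Pi.smul_apply, hρ, hσ, smul_eq_mul] at this
    rw [this]; norm_num
  have hp := hT.isPureState_of_pair_eq_one ha h
  rw [hT.eq_of_avg hp hρ' hτ, hT.eq_of_avg hp hσ' (hτ.trans (add_comm _ _))]

/-- Every pure state is identified with certainty by a pure effect: by Pure Sharpness some pure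
state is, and reversible channels carry it to all others. -/
theorem exists_effect {A : C} {α : T.St A} (hα : hT.IsPureState α) :
    ∃ a : T.Eff A, T.IsPure a ∧ T.pair a α = 1 := by
  obtain ⟨a, ha, ρ, h⟩ := hT.pureSharpness A
  obtain ⟨U, ⟨hU, V, hV, h1, h2⟩, e⟩ :=
    hT.exists_reversible_of_isPureState (hT.isPureState_of_pair_eq_one ha h) hα
  refine ⟨V ≫ a, hT.isPure_iso_comp ha V U hU h2 h1, ?_⟩
  rw [← pair_comp, e, Category.assoc, h1, Category.comp_id, h]

/-! ### Compactness of the set of pure states, and the invariant state -/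

/-- The action of a channel on families of probabilities. -/
def push {A B : C} (U : A ⟶ B) : (T.Eff A → ℝ) →ₗ[ℝ] (T.Eff B → ℝ) where
  toFun w b := w (U ≫ b)
  map_add' _ _ := rfl
  map_smul' _ _ := rfl

omit hT in
theorem push_stFun {A B : C} (U : A ⟶ B) (ρ : T.St A) :
    push U (T.stFun ρ) = T.stFun (ρ ≫ U) := by
  ext b
  exact (pair_comp U ρ b).symm

omit hT in
theorem push_mem_StR {A B : C} (U : A ⟶ B) {w : T.Eff A → ℝ} (hw : w ∈ T.StR A) :
    push U w ∈ T.StR B := by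
  have : T.StR A ≤ (T.StR B).comap (push U) := by
    refine Submodule.span_le.2 ?_
    rintro _ ⟨ρ, rfl⟩
    exact Submodule.subset_span ⟨ρ ≫ U, (push_stFun U ρ).symm⟩
  exact this hw

theorem body_subset_StR (A : C) : hT.body A ⊆ T.StR A := by
  rintro _ ⟨ρ, -, rfl⟩
  exact Submodule.subset_span ⟨ρ, rfl⟩

/-- Coordinates on the span of states.  The family of all probabilities lives in an infinite
product, where the theory of convex bodies in Euclidean space does not apply. -/
theorem exists_coordinates (A : C) :
    ∃ (n : ℕ) (J : EuclideanSpace ℝ (Fin n) →ₗ[ℝ] (T.Eff A → ℝ)), Function.Injective J ∧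
      Continuous J ∧ (∀ w, w ∈ T.StR A ↔ ∃ x, J x = w) ∧ IsCompact (J ⁻¹' hT.body A) := by
  have := hT.finiteSystems A
  let e₀ : T.StR A ≃ₗ[ℝ] EuclideanSpace ℝ (Fin (Module.finrank ℝ (T.StR A))) :=
    LinearEquiv.ofFinrankEq _ _ (by simp)
  let e := e₀.toContinuousLinearEquiv
  refine ⟨_, (T.StR A).subtype ∘ₗ e₀.symm.toLinearMap, ?_, ?_, fun w => ?_, ?_⟩
  · exact Subtype.val_injective.comp e₀.symm.injective
  · exact continuous_subtype_val.comp e.symm.continuous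
  · exact ⟨fun hw => ⟨e₀ ⟨w, hw⟩, by simp⟩, by rintro ⟨x, rfl⟩; exact (e₀.symm x).2⟩
  · have h1 : Topology.IsClosedEmbedding (Subtype.val : T.StR A → (T.Eff A → ℝ)) :=
      (Submodule.closed_of_finiteDimensional (T.StR A)).isClosedEmbedding_subtypeVal
    exact (h1.comp e.symm.toHomeomorph.isClosedEmbedding).isCompact_preimage (hT.isCompact_body A)

/-- The set of normalised pure states is compact, every normalised state has a pure component, and
some normalised state is invariant under all reversible channels. -/
theorem body_structure (A : C) :
    IsCompact {w | ∃ α : T.St A, hT.IsPureState α ∧ T.stFun α = w} ∧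
    (∀ ρ : T.St A, hT.IsNormalized ρ → ∃ w : ℝ, 0 < w ∧ w ≤ 1 ∧ ∃ α, hT.IsPureState α ∧
      ∃ σ, hT.IsNormalized σ ∧ T.stFun ρ = w • T.stFun α + (1 - w) • T.stFun σ) ∧
    ∃ χ : T.St A, hT.IsNormalized χ ∧ ∀ U : A ⟶ A, T.IsReversible U → χ ≫ U = χ := by
  obtain ⟨n, J, hJ, hJc, hJr, hN⟩ := hT.exists_coordinates A
  set N := J ⁻¹' hT.body A with hNdef
  have hsurj : ∀ {w}, w ∈ hT.body A → ∃ x ∈ N, J x = w := fun {w} hw => by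
    obtain ⟨x, rfl⟩ := (hJr w).1 (hT.body_subset_StR A hw)
    exact ⟨x, hw, rfl⟩
  have hconv : Convex ℝ N := (hT.convex_body A).linear_preimage J
  have hne : N.Nonempty := by
    obtain ⟨w, hw⟩ := hT.body_nonempty A
    obtain ⟨x, hx, -⟩ := hsurj hw
    exact ⟨x, hx⟩
  have hspan : Submodule.span ℝ N = ⊤ := by
    rw [eq_top_iff]
    have h1 : T.StR A ≤ (Submodule.span ℝ N).map J := by
      refine Submodule.span_le.2 ?_
      rintro _ ⟨ρ, rfl⟩
      obtain ⟨-, σ, hσ, e⟩ := hT.exists_of_mem_stCone (stFun_mem_stCone ρ)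
      obtain ⟨x, hx, e'⟩ := hsurj ⟨σ, hσ, rfl⟩
      rw [SetLike.mem_coe, e, ← e']
      exact Submodule.smul_mem _ _ ⟨x, Submodule.subset_span hx, rfl⟩
    intro x _
    obtain ⟨y, hy, e⟩ := h1 ((hJr (J x)).2 ⟨x, rfl⟩)
    rwa [← hJ e]
  have hext : ∀ x, x ∈ N.extremePoints ℝ ↔ J x ∈ (hT.body A).extremePoints ℝ := by
    intro x
    constructor
    · rintro ⟨hx, h⟩
      refine ⟨hx, fun w hw w' hw' => ?_⟩
      obtain ⟨y, hy, rfl⟩ := hsurj hw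
      obtain ⟨y', hy', rfl⟩ := hsurj hw'
      rintro ⟨a, b, ha, hb, hab, e⟩
      rw [← map_smul, ← map_smul, ← map_add] at e
      rw [h hy hy' ⟨a, b, ha, hb, hab, hJ e⟩]
    · rintro ⟨hx, h⟩
      refine ⟨hx, fun y hy y' hy' => ?_⟩
      rintro ⟨a, b, ha, hb, hab, e⟩
      refine hJ (h (x₁ := J y) hy (x₂ := J y') hy' ⟨a, b, ha, hb, hab, ?_⟩)
      rw [← map_smul, ← map_smul, ← map_add, e]
  have haut : ∀ U : A ⟶ A, T.IsReversible U → ∃ p ∈ autPairs N, ∀ x, J (p.1 x) = push U (J x) := by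
    rintro U ⟨hU, V, hV, h1, h2⟩
    have hL : ∀ W : A ⟶ A, ∃ L : EuclideanSpace ℝ (Fin n) →L[ℝ] EuclideanSpace ℝ (Fin n),
        ∀ x, J (L x) = push W (J x) := by
      intro W
      have hr : ∀ x, push W (J x) ∈ LinearMap.range J := fun x =>
        (hJr _).1 (push_mem_StR W ((hJr _).2 ⟨x, rfl⟩))
      let L₀ := (LinearEquiv.ofInjective J hJ).symm.toLinearMap ∘ₗ
        ((push W).comp J).codRestrict (LinearMap.range J) hr
      refine ⟨LinearMap.toContinuousLinearMap L₀, fun x => ?_⟩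
      have := congrArg Subtype.val ((LinearEquiv.ofInjective J hJ).apply_symm_apply
        ⟨push W (J x), hr x⟩)
      exact this
    obtain ⟨L, hL1⟩ := hL U
    obtain ⟨L', hL2⟩ := hL V
    have hmaps : ∀ {W : A ⟶ A} {L : EuclideanSpace ℝ (Fin n) →L[ℝ] EuclideanSpace ℝ (Fin n)},
        T.IsChannel W → (∀ x, J (L x) = push W (J x)) → Set.MapsTo L N N := by
      intro W L hW h x hx
      obtain ⟨ρ, hρ, e⟩ := hx
      exact ⟨ρ ≫ W, hT.isNormalized_comp hρ hW, by rw [h, ← e, push_stFun]⟩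
    refine ⟨(L, L'), ⟨?_, ?_, hmaps hU hL1, hmaps hV hL2⟩, hL1⟩
    · ext1 x
      refine hJ ?_
      change J (L (L' x)) = J x
      rw [hL1, hL2]
      ext a
      change J x (V ≫ U ≫ a) = J x a
      rw [← Category.assoc, h2, Category.id_comp]
    · ext1 x
      refine hJ ?_
      change J (L' (L x)) = J x
      rw [hL2, hL1]
      ext a
      change J x (U ≫ V ≫ a) = J x a
      rw [← Category.assoc, h1, Category.id_comp]
  have hcomp : IsCompact (N.extremePoints ℝ) := by
    refine isCompact_extremePoints_of_transitive hN hspan fun x hx y hy => ?_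
    rw [hext, hT.extremePoints_body] at hx hy
    obtain ⟨α, hα, ex⟩ := hx
    obtain ⟨β, hβ, ey⟩ := hy
    obtain ⟨U, hU, rfl⟩ := hT.exists_reversible_of_isPureState hα hβ
    obtain ⟨p, hp, h⟩ := haut U hU
    exact ⟨p, hp, hJ (by rw [h, ← ex, ← ey, push_stFun])⟩
  refine ⟨?_, ?_, ?_⟩
  · have : {w | ∃ α : T.St A, hT.IsPureState α ∧ T.stFun α = w} = J '' N.extremePoints ℝ := by
      rw [← hT.extremePoints_body]
      ext w
      constructor
      · intro hw
        obtain ⟨x, hx, rfl⟩ := hsurj hw.1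
        exact ⟨x, (hext x).2 hw, rfl⟩
      · rintro ⟨x, hx, rfl⟩
        exact (hext x).1 hx
    rw [this]
    exact hcomp.image hJc
  · intro ρ hρ
    obtain ⟨c, hc, h⟩ := exists_extreme_component hN hconv hcomp
    obtain ⟨x, hx, ex⟩ := hsurj ⟨ρ, hρ, rfl⟩
    obtain ⟨w, ⟨hw, hw1⟩, y, hy, z, hz, e⟩ := h x hx
    rw [hext, hT.extremePoints_body] at hy
    obtain ⟨α, hα, eα⟩ := hy
    obtain ⟨σ, hσ, eσ⟩ := hz
    exact ⟨w, hc.trans_le hw, hw1, α, hα, σ, hσ, by rw [← ex, e, eα, eσ]; simp⟩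
  · obtain ⟨x, hx, h⟩ := exists_fixed_of_autPairs hN hconv hne hspan
    obtain ⟨χ, hχ, e⟩ := hx
    refine ⟨χ, hχ, fun U hU => hT.st_ext ?_⟩
    obtain ⟨p, hp, h'⟩ := haut U hU
    rw [← push_stFun, e, ← h', h p hp]

end IsSharpWithPurification
end OPTData

namespace OPTData

variable {C : Type u} [Category.{v} C] [MonoidalCategory C] [SymmetricCategory C] {T : OPTData C}

/-- A normalised pure state as a family of probabilities. -/
def vec {A : C} (α : T.PurSt₁ A) : T.Eff A → ℝ := T.stFun α.1

theorem vec_mem_stCone {A : C} (α : T.PurSt₁ A) : vec α ∈ T.stCone A := stFun_mem_stCone α.1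

namespace IsSharpWithPurification

variable (hT : T.IsSharpWithPurification)

/-! ### The dagger of pure states -/

include hT

theorem isPureState {A : C} (α : T.PurSt₁ A) :
    hT.IsPureState α.1 :=
  ⟨α.2.1, (hT.isNormalized_iff _).2 α.2.2⟩

/-- Bundling of a normalised pure state. -/
def mkPure {A : C} {α : T.St A} (h : hT.IsPureState α) : T.PurSt₁ A :=
  ⟨α, h.1, (hT.isNormalized_iff _).1 h.2⟩

theorem vec_mkPure {A : C} {α : T.St A} (h : hT.IsPureState α) : vec (hT.mkPure h) = T.stFun α :=
  rfl

theorem vec_discard {A : C} (α : T.PurSt₁ A) : vec α (hT.discard A) = 1 := (hT.isPureState α).2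

/-- If a multiple of `β` is pure, so is `β`: a refinement of `β` gives one of the multiple,
through a biased coin. -/
theorem isPure_of_smul {A : C} {f β : T.St A} (hf : T.IsPure f) {c : ℝ} (hc : 0 < c) (hc1 : c ≤ 1)
    (h : T.stFun f = c • T.stFun β) : T.IsPure β := by
  intro Y D s hD hs hS
  obtain ⟨q, hq, hq1, -⟩ := hT.exists_scalar hc.le hc1
  have h1 := hT.test_comp (Y := fun _ : Bool => Y) q (fun _ => D) hq (fun _ => hD)
  let i : Y ↪ Σ _ : Bool, Y := Function.Embedding.sigmaMk (β := fun _ : Bool => Y) true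
  obtain ⟨p, hp0, hp1, hp⟩ := hf _ (s.map i) h1 (by simpa using hs) (isSum_of_pair fun a => by
    rw [Finset.sum_map]
    have e := congrFun h a
    simp only [stFun_apply, Pi.smul_apply, smul_eq_mul] at e
    simp only [i, Function.Embedding.sigmaMk_apply, hT.pair_scalar_comp, hq1]
    rw [e, hS.pair, Finset.mul_sum])
  refine ⟨fun y => p (i y), fun y hy => hp0 _ (Finset.mem_map_of_mem i hy), ?_, fun y hy => ?_⟩
  · rw [← hp1, Finset.sum_map]
  · refine isScale_of_pair fun a => ?_
    have e := (hp (i y) (Finset.mem_map_of_mem i hy)).pair a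
    have e2 := congrFun h a
    simp only [stFun_apply, Pi.smul_apply, smul_eq_mul] at e2
    simp only [i, Function.Embedding.sigmaMk_apply, hT.pair_scalar_comp, hq1, e2] at e
    exact mul_left_cancel₀ hc.ne' (by rw [e]; simp only [i, Function.Embedding.sigmaMk_apply]; ring)

/-- Pure states are multiples of normalised pure states. -/
theorem exists_vec_of_isPure {A : C} {f : T.St A} (hf : T.IsPure f) :
    ∃ α : T.PurSt₁ A, T.stFun f = T.pair (hT.discard A) f • vec α := by
  obtain ⟨h0, ρ, hρ, e⟩ := hT.exists_of_mem_stCone (stFun_mem_stCone f)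
  rcases h0.eq_or_lt with h | h
  · obtain ⟨α, hα⟩ := hT.exists_isPureState A
    exact ⟨hT.mkPure hα, by rw [e, ← h, ← stFun_apply, ← h, zero_smul, zero_smul]⟩
  · exact ⟨hT.mkPure ⟨hT.isPure_of_smul hf h (hT.pair_le_one _ _) e, hρ⟩, e⟩

theorem condR_sub_mem_stCone {A B : C} (Ψ : T.St (A ⊗ B)) (b : T.Eff B) :
    T.stFun (condR (hT.discard B) Ψ) - T.stFun (condR b Ψ) ∈ T.stCone A := by
  obtain ⟨b', h⟩ := hT.exists_compl b
  refine ⟨1, zero_le_one, condR b' Ψ, ?_⟩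
  ext a
  have := h (condL a Ψ)
  simp only [pair_condL'] at this
  simp only [Pi.sub_apply, stFun_apply, one_smul]
  linarith

/-- Every normalised state has a pure component of largest weight. -/
theorem exists_max_component {A : C} {ρ : T.St A} (hρ : hT.IsNormalized ρ) :
    ∃ w : ℝ, 0 < w ∧ ∃ α : T.PurSt₁ A, T.stFun ρ - w • vec α ∈ T.stCone A ∧
      ∀ (w' : ℝ) (α' : T.PurSt₁ A), T.stFun ρ - w' • vec α' ∈ T.stCone A → w' ≤ w := by
  obtain ⟨hP, hcomp, -⟩ := hT.body_structure A
  set K : Set (ℝ × (T.Eff A → ℝ) × (T.Eff A → ℝ)) :=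
    (Set.Icc 0 1 ×ˢ {w | ∃ α : T.St A, hT.IsPureState α ∧ T.stFun α = w} ×ˢ hT.body A) ∩
      {q | q.1 • q.2.1 + (1 - q.1) • q.2.2 = T.stFun ρ} with hK
  have hKc : IsCompact K :=
    (isCompact_Icc.prod (hP.prod (hT.isCompact_body A))).inter_right
      (isClosed_eq (by fun_prop) continuous_const)
  obtain ⟨w₀, h0, h1, α₀, hα₀, σ₀, hσ₀, e₀⟩ := hcomp ρ hρ
  have hq₀ : (w₀, T.stFun α₀, T.stFun σ₀) ∈ K :=
    ⟨⟨⟨h0.le, h1⟩, ⟨α₀, hα₀, rfl⟩, ⟨σ₀, hσ₀, rfl⟩⟩, e₀.symm⟩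
  obtain ⟨⟨w, _, _⟩, ⟨⟨hw, ⟨α, hα, rfl⟩, ⟨σ, hσ, rfl⟩⟩, e⟩, hmax⟩ :=
    hKc.exists_isMaxOn ⟨_, hq₀⟩ continuous_fst.continuousOn
  have hw0 : 0 < w := h0.trans_le (hmax hq₀)
  refine ⟨w, hw0, hT.mkPure hα, ?_, fun w' α' h' => ?_⟩
  · refine ⟨1 - w, by linarith [hw.2], σ, ?_⟩
    rw [vec_mkPure, ← e]; simp
  · by_contra! hlt
    obtain ⟨h2, σ', hσ', e'⟩ := hT.exists_of_mem_stCone h'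
    have h3 : (T.stFun ρ - w' • vec α') (hT.discard A) = 1 - w' := by
      unfold IsNormalized at hρ
      rw [Pi.sub_apply, Pi.smul_apply, hρ, hT.vec_discard, smul_eq_mul, mul_one]
    rw [h3] at h2 e'
    have : (w', T.stFun α'.1, T.stFun σ') ∈ K :=
      ⟨⟨⟨(hw0.trans hlt).le, by linarith⟩, ⟨α'.1, hT.isPureState α', rfl⟩, ⟨σ', hσ', rfl⟩⟩, by
        change w' • vec α' + (1 - w') • T.stFun σ' = T.stFun ρ
        rw [← e']; simp⟩
    exact absurd (hmax this) (not_le.2 hlt)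

/-- The correspondence between the components of largest weight of the two marginals of a pure
bipartite state: if no pure component of the marginal on `A` has weight above `q`, and the pure
effect `a` identifying `α` has probability at least `q`, then `a` steers the other system to a pure
state `β` with probability `q`, and the effect identifying `β` steers to `q α`. -/
theorem exists_partner {A B : C} {Ψ : T.St (A ⊗ B)} (hΨ : T.IsPure Ψ) {a : T.Eff A}
    (ha : T.IsPure a) {α : T.PurSt₁ A} (haα : vec α a = 1) {q : ℝ} (hq : 0 < q)
    (hqa : q ≤ T.pair a (condR (hT.discard B) Ψ))
    (hmax : ∀ (w : ℝ) (α' : T.PurSt₁ A),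
      T.stFun (condR (hT.discard B) Ψ) - w • vec α' ∈ T.stCone A → w ≤ q) :
    T.pair a (condR (hT.discard B) Ψ) = q ∧ ∃ (β : T.PurSt₁ B) (b : T.Eff B), T.IsPure b ∧
      vec β b = 1 ∧ T.stFun (condL a Ψ) = q • vec β ∧ T.stFun (condR b Ψ) = q • vec α := by
  obtain ⟨β, hβ⟩ := hT.exists_vec_of_isPure (hT.isPure_condL ha hΨ)
  obtain ⟨b, hb, hbβ⟩ := hT.exists_effect (hT.isPureState β)
  obtain ⟨α', hα'⟩ := hT.exists_vec_of_isPure (hT.isPure_condR hb hΨ)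
  have hbβ' : vec β b = 1 := hbβ
  have e1 := congrFun hβ b
  have e2 := congrFun hα' a
  rw [stFun_apply, Pi.smul_apply, hbβ', smul_eq_mul, mul_one, pair_condL', pair_condL'] at e1
  rw [stFun_apply, Pi.smul_apply, smul_eq_mul] at e2
  have h1 := hT.condR_sub_mem_stCone Ψ b
  rw [hα'] at h1
  have h2 := hmax _ α' h1
  set w := T.pair (hT.discard A) (condR b Ψ) with hw
  have h3 : vec α' a ≤ 1 := hT.pair_le_one _ _
  have h4 : 0 ≤ w := hT.pair_nonneg _ _
  have h5 : w = q := by nlinarith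
  have h6 : vec α' a = 1 := by
    rw [h5] at e2
    have : q ≤ q * vec α' a := by linarith
    nlinarith
  have h7 : α' = α := Subtype.ext (hT.eq_of_pair_eq_one ha h6 haα)
  have h8 : T.pair a (condR (hT.discard B) Ψ) = q := by rw [← e1, e2, h5, h6, mul_one]
  refine ⟨h8, β, b, hb, hbβ', ?_, ?_⟩
  · rw [hβ, pair_condL', h8]
  · rw [hα', h5, h7]

omit hT in
theorem push_mem_stCone {A B : C} (U : A ⟶ B) {w : T.Eff A → ℝ} (hw : w ∈ T.stCone A) :
    push U w ∈ T.stCone B := by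
  obtain ⟨c, hc, ρ, rfl⟩ := hw
  exact ⟨c, hc, ρ ≫ U, by rw [map_smul, push_stFun]⟩

/-- The invariant state contains all pure states with the same largest weight. -/
theorem exists_invariant (A : C) : ∃ (χ : T.St A) (p : ℝ), hT.IsNormalized χ ∧ 0 < p ∧
    (∀ α : T.PurSt₁ A, T.stFun χ - p • vec α ∈ T.stCone A) ∧
    ∀ (w : ℝ) (α : T.PurSt₁ A), T.stFun χ - w • vec α ∈ T.stCone A → w ≤ p := by
  obtain ⟨-, -, χ, hχ, hinv⟩ := hT.body_structure A
  obtain ⟨p, hp, α₀, h0, hmax⟩ := hT.exists_max_component hχ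
  refine ⟨χ, p, hχ, hp, fun α => ?_, hmax⟩
  obtain ⟨U, hU, e⟩ := hT.exists_reversible_of_isPureState (hT.isPureState α₀) (hT.isPureState α)
  have h1 := push_mem_stCone U h0
  rw [map_sub, map_smul, push_stFun, hinv U hU, vec, push_stFun, ← e] at h1
  exact h1

/-- Effects are determined by their values on normalised pure states. -/
theorem eff_ext_of_pure {A : C} {a a' : T.Eff A} (h : ∀ α : T.PurSt₁ A, vec α a = vec α a') :
    a = a' := by
  refine hT.eff_ext fun ρ => ?_
  obtain ⟨-, σ, hσ, e⟩ := hT.exists_of_mem_stCone (stFun_mem_stCone ρ)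
  have hc : IsClosed {w : T.Eff A → ℝ | w a = w a'} :=
    isClosed_eq (continuous_apply _) (continuous_apply _)
  have hconv : Convex ℝ {w : T.Eff A → ℝ | w a = w a'} := by
    intro x hx y hy s t _ _ _
    rw [Set.mem_ofPred_eq] at hx hy
    simp [hx, hy]
  have h1 : T.stFun σ a = T.stFun σ a' :=
    hT.mem_of_forall_isPureState hc hconv (fun α hα => h (hT.mkPure hα)) hσ
  rw [← stFun_apply, ← stFun_apply, e, Pi.smul_apply, Pi.smul_apply, h1]

/-- The pure effect that identifies a pure state is unique: two such effects steer a purification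
of the invariant state to the same state, and every pure state can be steered to. -/
theorem effect_unique {A : C} {α : T.PurSt₁ A} {a a' : T.Eff A} (ha : T.IsPure a)
    (haα : vec α a = 1) (ha' : T.IsPure a') (haα' : vec α a' = 1) : a = a' := by
  obtain ⟨χ, p, hχ, hp, hle, hmax⟩ := hT.exists_invariant A
  obtain ⟨B, Φ, hΦ, hΦn, rfl⟩ := hT.exists_purification hχ
  have key : ∀ {γ : T.PurSt₁ A} {c : T.Eff A}, T.IsPure c → vec γ c = 1 →
      ∃ (β : T.PurSt₁ B) (b : T.Eff B), T.IsPure b ∧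
      vec β b = 1 ∧ T.stFun (condL c Φ) = p • vec β ∧ T.stFun (condR b Φ) = p • vec γ := by
    intro γ c hc hcγ
    refine (hT.exists_partner hΦ hc hcγ hp ?_ hmax).2
    have := hT.nonneg_of_mem_stCone (hle γ) c
    rw [Pi.sub_apply, Pi.smul_apply, hcγ, smul_eq_mul, mul_one, stFun_apply] at this
    linarith
  obtain ⟨β, b, hb, hbβ, e1, e2⟩ := key ha haα
  obtain ⟨β', b', hb', hbβ', e1', e2'⟩ := key ha' haα'
  have h1 : vec β' b = 1 := by
    have h2 := congrFun e1' b
    have h3 := congrFun e2 a'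
    rw [stFun_apply, pair_condL'] at h2
    rw [stFun_apply, h2, Pi.smul_apply, Pi.smul_apply, haα'] at h3
    exact mul_left_cancel₀ hp.ne' h3
  have h2 : β' = β := Subtype.ext (hT.eq_of_pair_eq_one hb h1 hbβ)
  refine hT.eff_ext_of_pure fun s => ?_
  obtain ⟨c, hc, hcs⟩ := hT.exists_effect (hT.isPureState s)
  obtain ⟨-, bs, -, -, -, es⟩ := key (γ := s) hc hcs
  have h3 := congrFun es a
  have h4 := congrFun es a'
  rw [stFun_apply, ← pair_condL', ← stFun_apply, e1] at h3
  rw [stFun_apply, ← pair_condL', ← stFun_apply, e1', h2, h3] at h4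
  exact mul_left_cancel₀ hp.ne' h4

/-- The normalised pure effect that identifies a normalised pure state. -/
noncomputable def dag {A : C} (α : T.PurSt₁ A) : T.Eff A :=
  (hT.exists_effect (hT.isPureState α)).choose

theorem isPure_dag {A : C} (α : T.PurSt₁ A) : T.IsPure (hT.dag α) :=
  (hT.exists_effect (hT.isPureState α)).choose_spec.1

theorem vec_dag_self {A : C} (α : T.PurSt₁ A) : vec α (hT.dag α) = 1 :=
  (hT.exists_effect (hT.isPureState α)).choose_spec.2

theorem eq_dag {A : C} {α : T.PurSt₁ A} {a : T.Eff A} (ha : T.IsPure a) (h : vec α a = 1) :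
    a = hT.dag α :=
  hT.effect_unique ha h (hT.isPure_dag α) (hT.vec_dag_self α)

theorem vec_dag_nonneg {A : C} (α β : T.PurSt₁ A) : 0 ≤ vec α (hT.dag β) := hT.pair_nonneg _ _

theorem vec_dag_le_one {A : C} (α β : T.PurSt₁ A) : vec α (hT.dag β) ≤ 1 := hT.pair_le_one _ _

theorem eq_of_stFun_dag_eq_one {A : C} {α : T.PurSt₁ A} {ρ : T.St A}
    (h : T.stFun ρ (hT.dag α) = 1) : ρ = α.1 :=
  hT.eq_of_pair_eq_one (hT.isPure_dag α) h (hT.vec_dag_self α)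

theorem eq_of_vec_dag_eq_one {A : C} {α β : T.PurSt₁ A} (h : vec β (hT.dag α) = 1) : β = α :=
  Subtype.ext (hT.eq_of_stFun_dag_eq_one h)

/-! ### Components of states -/

/-- A bound on the probabilities of all pure effects that is attained at `γ` is the weight of `γ`
as a component. -/
theorem sub_mem_stCone {A : C} {r : T.Eff A → ℝ} (hr : r ∈ T.stCone A) {q : ℝ} {γ : T.PurSt₁ A}
    (hle : ∀ γ' : T.PurSt₁ A, r (hT.dag γ') ≤ q) (hq : r (hT.dag γ) = q) :
    r - q • vec γ ∈ T.stCone A := by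
  have hq0 : 0 ≤ q := hq ▸ hT.nonneg_of_mem_stCone hr _
  rcases hq0.eq_or_lt with h | h
  · rw [← h, zero_smul, sub_zero]; exact hr
  obtain ⟨-, ρ, hρ, e⟩ := hT.exists_of_mem_stCone hr
  set t := r (hT.discard A) with ht
  have ht0 : 0 < t := h.trans_le (hq ▸ hT.le_discard_of_mem_stCone hr _)
  obtain ⟨B, Ψ, hp, hn, rfl⟩ := hT.exists_purification hρ
  have hval : ∀ γ', r (hT.dag γ') = t * T.stFun (condR (hT.discard B) Ψ) (hT.dag γ') := fun γ' => by
    conv_lhs => rw [e]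
    rfl
  obtain ⟨-, β, b, -, -, -, hb⟩ := hT.exists_partner hp (hT.isPure_dag γ) (hT.vec_dag_self γ)
    (q := q / t) (div_pos h ht0)
    (by rw [div_le_iff₀ ht0, mul_comm, ← stFun_apply, ← hval, hq])
    (fun w α' hw => by
      have h1 := hT.nonneg_of_mem_stCone hw (hT.dag α')
      rw [Pi.sub_apply, Pi.smul_apply, hT.vec_dag_self, smul_eq_mul, mul_one] at h1
      have h2 := hle α'
      rw [hval] at h2
      rw [le_div_iff₀ ht0]
      nlinarith)
  have h1 := smul_mem_stCone (hT.condR_sub_mem_stCone Ψ b) ht0.le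
  rw [hb, smul_sub, smul_smul, mul_div_cancel₀ _ ht0.ne', ← e] at h1
  exact h1

end IsSharpWithPurification
end OPTData

namespace OPTData

variable {C : Type u} [Category.{v} C] [MonoidalCategory C] [SymmetricCategory C] {T : OPTData C}

namespace IsSharpWithPurification

variable (hT : T.IsSharpWithPurification)

/-! ### Conjugation and orthogonality -/

/-- A purification `Φ` of a normalised state `χ` of `A` in which every pure state `α` has the same
largest weight `p`, such as the invariant state.  It pairs `α` with a pure state `conj α` of the
purifying system `B`: each is steered to by the dagger of the other.  This turns effects of `A`,
bounded on pure states, into states of `B`. -/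
structure Conjugate (A : C) where
  p : ℝ
  χ : T.St A
  B : C
  Φ : T.St (A ⊗ B)
  conj : T.PurSt₁ A → T.PurSt₁ B
  pos : 0 < p
  normalized : hT.IsNormalized χ
  dag_χ : ∀ α, T.stFun χ (hT.dag α) = p
  sub_mem : ∀ α, T.stFun χ - p • vec α ∈ T.stCone A
  condL_dag : ∀ α, T.stFun (condL (hT.dag α) Φ) = p • vec (conj α)
  condR_dag : ∀ α, T.stFun (condR (hT.dag (conj α)) Φ) = p • vec α
  condR_le : ∀ γ : T.PurSt₁ B, ∃ (t : ℝ) (s : T.PurSt₁ A), 0 ≤ t ∧ t ≤ p ∧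
    T.stFun (condR (hT.dag γ) Φ) = t • vec s

include hT

theorem exists_conjugate (A : C) : Nonempty (hT.Conjugate A) := by
  obtain ⟨χ, p, hχ, hp, hle, hmax⟩ := hT.exists_invariant A
  obtain ⟨B, Φ, hΦ, hΦn, rfl⟩ := hT.exists_purification hχ
  have key : ∀ γ : T.PurSt₁ A, T.pair (hT.dag γ) (condR (hT.discard B) Φ) = p ∧
      ∃ (β : T.PurSt₁ B) (b : T.Eff B), T.IsPure b ∧ vec β b = 1 ∧
      T.stFun (condL (hT.dag γ) Φ) = p • vec β ∧ T.stFun (condR b Φ) = p • vec γ := by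
    intro γ
    refine hT.exists_partner hΦ (hT.isPure_dag γ) (hT.vec_dag_self γ) hp ?_ hmax
    have := hT.nonneg_of_mem_stCone (hle γ) (hT.dag γ)
    rw [Pi.sub_apply, Pi.smul_apply, hT.vec_dag_self, smul_eq_mul, mul_one, stFun_apply] at this
    linarith
  choose conj b hb hbc h1 h2 using fun γ => (key γ).2
  refine ⟨⟨p, _, B, Φ, conj, hp, hχ, fun α => (key α).1, hle, h1, fun α => ?_, fun γ => ?_⟩⟩
  · rw [← hT.eq_dag (hb α) (hbc α)]; exact h2 α
  · obtain ⟨s, hs⟩ := hT.exists_vec_of_isPure (hT.isPure_condR (hT.isPure_dag γ) hΦ)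
    refine ⟨_, s, hT.pair_nonneg _ _, hmax _ s ?_, hs⟩
    rw [← hs]
    exact hT.condR_sub_mem_stCone Φ _

omit hT in
/-- Conjugation transposes transition probabilities. -/
theorem Conjugate.vec_conj_dag {hT : T.IsSharpWithPurification} {A : C} (K : hT.Conjugate A)
    (α s : T.PurSt₁ A) : vec (K.conj α) (hT.dag (K.conj s)) = vec s (hT.dag α) := by
  have h1 := congrFun (K.condL_dag α) (hT.dag (K.conj s))
  have h2 := congrFun (K.condR_dag s) (hT.dag α)
  rw [stFun_apply, pair_condL', ← stFun_apply, h2] at h1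
  exact (mul_left_cancel₀ K.pos.ne' h1).symm

omit hT in
/-- If a functional `l`, at most one on pure states and equal to one on `α`, is represented by an
element `w` of the cone of the conjugate system, then `conj α` is a component of `w`. -/
theorem Conjugate.sub_conj_mem {hT : T.IsSharpWithPurification} {A : C} (K : hT.Conjugate A)
    {w : T.Eff K.B → ℝ} (hw : w ∈ T.stCone K.B) (l : (T.Eff A → ℝ) →ₗ[ℝ] ℝ)
    (hwl : ∀ b, w b = l (T.stFun (condR b K.Φ))) (hl : ∀ s : T.PurSt₁ A, l (vec s) ≤ 1)
    {α : T.PurSt₁ A} (hα : l (vec α) = 1) : w - K.p • vec (K.conj α) ∈ T.stCone K.B := by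
  refine hT.sub_mem_stCone hw (fun γ => ?_) ?_
  · obtain ⟨t, s, ht, htp, e⟩ := K.condR_le γ
    rw [hwl, e, map_smul, smul_eq_mul]
    nlinarith [hl s]
  · rw [hwl, K.condR_dag, map_smul, hα, smul_eq_mul, mul_one]

/-- The dagger of a pure state `α` is the smallest effect occurring with certainty on `α`. -/
theorem dag_le_of_eq_one {A : C} {e : T.Eff A} {α : T.PurSt₁ A} (h : vec α e = 1)
    (s : T.PurSt₁ A) : vec s (hT.dag α) ≤ vec s e := by
  obtain ⟨K⟩ := hT.exists_conjugate A
  have h1 := K.sub_conj_mem (stFun_mem_stCone (condL e K.Φ)) (LinearMap.proj e)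
    (fun b => by rw [LinearMap.proj_apply, stFun_apply, pair_condL', stFun_apply])
    (fun s => hT.pair_le_one _ _) h
  have h2 := hT.nonneg_of_mem_stCone h1 (hT.dag (K.conj s))
  rw [Pi.sub_apply, Pi.smul_apply, K.vec_conj_dag, stFun_apply, pair_condL', ← stFun_apply,
    K.condR_dag, Pi.smul_apply, smul_eq_mul, smul_eq_mul] at h2
  exact le_of_mul_le_mul_left (by linarith) K.pos

theorem vec_compl {A : C} {a a' : T.Eff A}
    (h : ∀ ρ, T.pair a ρ + T.pair a' ρ = T.pair (hT.discard A) ρ) (s : T.PurSt₁ A) :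
    vec s a' = 1 - vec s a := by
  have h1 : T.pair (hT.discard A) s.1 = 1 := hT.vec_discard s
  have h2 := h s.1
  change T.pair a' s.1 = 1 - T.pair a s.1
  linarith

/-- Orthogonality is symmetric: if `o†` never occurs on `s`, its complement dominates `s†`. -/
theorem orth_symm {A : C} {o s : T.PurSt₁ A} (h : vec s (hT.dag o) = 0) :
    vec o (hT.dag s) = 0 := by
  obtain ⟨e, he⟩ := hT.exists_compl (hT.dag o)
  have h1 := hT.dag_le_of_eq_one (e := e) (α := s) (by rw [hT.vec_compl he, h, sub_zero]) o
  rw [hT.vec_compl he, hT.vec_dag_self, sub_self] at h1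
  exact le_antisymm h1 (hT.vec_dag_nonneg _ _)

/-- The daggers of orthogonal pure states coexist. -/
theorem dag_add_le {A : C} {o o' : T.PurSt₁ A} (h : vec o (hT.dag o') = 0) (s : T.PurSt₁ A) :
    vec s (hT.dag o) + vec s (hT.dag o') ≤ 1 := by
  obtain ⟨e, he⟩ := hT.exists_compl (hT.dag o')
  have h1 := hT.dag_le_of_eq_one (e := e) (α := o) (by rw [hT.vec_compl he, h, sub_zero]) s
  rw [hT.vec_compl he] at h1
  linarith

/-- Inequalities between continuous functionals on the cone may be checked on pure states. -/
theorem nonneg_of_forall_vec {A : C} (l : (T.Eff A → ℝ) →L[ℝ] ℝ)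
    (h : ∀ s : T.PurSt₁ A, 0 ≤ l (vec s)) {w : T.Eff A → ℝ} (hw : w ∈ T.stCone A) : 0 ≤ l w := by
  obtain ⟨h0, ρ, hρ, e⟩ := hT.exists_of_mem_stCone hw
  have hc : IsClosed {w : T.Eff A → ℝ | 0 ≤ l w} := isClosed_le continuous_const l.continuous
  have hconv : Convex ℝ {w : T.Eff A → ℝ | 0 ≤ l w} :=
    convex_halfSpace_ge l.toLinearMap.isLinear 0
  have h1 : 0 ≤ l (T.stFun ρ) :=
    hT.mem_of_forall_isPureState hc hconv (fun α hα => h (hT.mkPure hα)) hρ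
  rw [e, map_smul]
  exact mul_nonneg h0 h1

theorem eq_zero_of_forall_vec {A : C} (l : (T.Eff A → ℝ) →L[ℝ] ℝ)
    (h : ∀ s : T.PurSt₁ A, l (vec s) = 0) {w : T.Eff A → ℝ} (hw : w ∈ T.stCone A) : l w = 0 := by
  have h1 := hT.nonneg_of_forall_vec l (fun s => (h s).ge) hw
  have h2 := hT.nonneg_of_forall_vec (-l) (fun s => by simp [h s]) hw
  rw [neg_apply] at h2
  linarith

theorem dag_add_le_discard {A : C} {o o' : T.PurSt₁ A} (h : vec o (hT.dag o') = 0)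
    {w : T.Eff A → ℝ} (hw : w ∈ T.stCone A) :
    w (hT.dag o) + w (hT.dag o') ≤ w (hT.discard A) := by
  have := hT.nonneg_of_forall_vec (.proj (hT.discard A) - .proj (hT.dag o) - .proj (hT.dag o'))
    (fun s => by
      have := hT.dag_add_le h s
      simp [hT.vec_discard]; linarith) hw
  simp at this
  linarith

omit hT in
/-- Orthogonal pure states are jointly components of the invariant state. -/
theorem Conjugate.sub_sub_mem {hT : T.IsSharpWithPurification} {A : C} (K : hT.Conjugate A)
    {o o' : T.PurSt₁ A} (h : vec o (hT.dag o') = 0) :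
    T.stFun K.χ - K.p • vec o - K.p • vec o' ∈ T.stCone A := by
  refine hT.sub_mem_stCone (K.sub_mem o) (fun γ => ?_) ?_
  · rw [Pi.sub_apply, Pi.smul_apply, K.dag_χ, smul_eq_mul]
    nlinarith [hT.vec_dag_nonneg o γ, K.pos]
  · rw [Pi.sub_apply, Pi.smul_apply, K.dag_χ, smul_eq_mul, h]; ring

theorem vec_add_le {A : C} {o o' : T.PurSt₁ A} (h : vec o (hT.dag o') = 0) (γ : T.PurSt₁ A) :
    vec o (hT.dag γ) + vec o' (hT.dag γ) ≤ 1 := by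
  obtain ⟨K⟩ := hT.exists_conjugate A
  have h1 := hT.nonneg_of_mem_stCone (K.sub_sub_mem h) (hT.dag γ)
  simp only [Pi.sub_apply, Pi.smul_apply, K.dag_χ, smul_eq_mul] at h1
  refine le_of_mul_le_mul_left ?_ K.pos
  linarith

/-! ### Two-level faces -/

omit hT in
/-- The representative of `o† + o'†` in the conjugate system contains `conj α`. -/
theorem Conjugate.add_sub_mem {hT : T.IsSharpWithPurification} {A : C} (K : hT.Conjugate A)
    {o o' α : T.PurSt₁ A} (h : vec o (hT.dag o') = 0)
    (hα : vec α (hT.dag o) + vec α (hT.dag o') = 1) :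
    vec (K.conj o) + vec (K.conj o') - vec (K.conj α) ∈ T.stCone K.B := by
  have h1 := K.sub_conj_mem (w := K.p • (vec (K.conj o) + vec (K.conj o')))
    (smul_mem_stCone (hT.add_mem_stCone (vec_mem_stCone _) (vec_mem_stCone _)) K.pos.le)
    (.proj (hT.dag o) + .proj (hT.dag o') : (T.Eff A → ℝ) →L[ℝ] ℝ).toLinearMap
    (fun b => by
      rw [smul_add, ← K.condL_dag, ← K.condL_dag, Pi.add_apply, stFun_apply, stFun_apply,
        pair_condL', pair_condL']
      rfl)
    (hT.dag_add_le h) hα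
  rw [← smul_sub] at h1
  have h2 := smul_mem_stCone h1 (inv_nonneg.2 K.pos.le)
  rwa [smul_smul, inv_mul_cancel₀ K.pos.ne', one_smul] at h2

theorem dag_le_dag_add {A : C} {o o' α : T.PurSt₁ A} (h : vec o (hT.dag o') = 0)
    (hα : vec α (hT.dag o) + vec α (hT.dag o') = 1) (s : T.PurSt₁ A) :
    vec s (hT.dag α) ≤ vec s (hT.dag o) + vec s (hT.dag o') := by
  obtain ⟨K⟩ := hT.exists_conjugate A
  have h1 := hT.nonneg_of_mem_stCone (K.add_sub_mem h hα) (hT.dag (K.conj s))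
  simp only [Pi.sub_apply, Pi.add_apply, K.vec_conj_dag] at h1
  linarith

theorem vec_dag_add_eq_one {A : C} {o o' α : T.PurSt₁ A} (h : vec o (hT.dag o') = 0)
    (hα : vec α (hT.dag o) + vec α (hT.dag o') = 1) :
    vec o (hT.dag α) + vec o' (hT.dag α) = 1 := by
  obtain ⟨K⟩ := hT.exists_conjugate A
  have h1 := hT.nonneg_of_forall_vec (.proj (hT.dag o) + .proj (hT.dag o') - .proj (hT.dag α))
    (fun s => by have := hT.dag_le_dag_add h hα s; simp; linarith) (K.sub_sub_mem h)
  simp only [sub_apply, add_apply, ContinuousLinearMap.proj_apply, Pi.sub_apply, Pi.smul_apply,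
    K.dag_χ, smul_eq_mul,
    hT.vec_dag_self, hT.orth_symm h, h] at h1
  refine le_antisymm (hT.vec_add_le h α) (le_of_mul_le_mul_left ?_ K.pos)
  linarith

/-- Within the face of two orthogonal pure states `o` and `o'`, which consists of the states on
which `o†` and `o'†` have total probability one, every pure state `α` has an antipode, `o + o' - α`. -/
theorem exists_antipode {A : C} {o o' α : T.PurSt₁ A} (h : vec o (hT.dag o') = 0)
    (hα : vec α (hT.dag o) + vec α (hT.dag o') = 1) :
    ∃ τ : T.PurSt₁ A, vec τ = vec o + vec o' - vec α ∧ vec τ (hT.dag α) = 0 ∧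
      ∀ s, vec s (hT.dag τ) = vec s (hT.dag o) + vec s (hT.dag o') - vec s (hT.dag α) := by
  have hα' := hT.vec_dag_add_eq_one h hα
  have h1 : vec o + vec o' - (1 : ℝ) • vec α ∈ T.stCone A :=
    hT.sub_mem_stCone (hT.add_mem_stCone (vec_mem_stCone o) (vec_mem_stCone o'))
      (hT.vec_add_le h) hα'
  rw [one_smul] at h1
  obtain ⟨ρ, hρ, e⟩ := hT.exists_of_mem_stCone_of_eq_one h1 (by
    simp only [Pi.sub_apply, Pi.add_apply, hT.vec_discard]; norm_num)
  have hρα : T.stFun ρ (hT.dag α) = 0 := by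
    rw [e, Pi.sub_apply, Pi.add_apply, hα', hT.vec_dag_self, sub_self]
  have hρe : T.stFun ρ (hT.dag o) + T.stFun ρ (hT.dag o') = 1 := by
    rw [e]
    simp only [Pi.sub_apply, Pi.add_apply, hT.vec_dag_self, h, hT.orth_symm h]
    linarith
  -- A pure component of `o + o' - α` is orthogonal to `α` and lies in the same face.
  obtain ⟨w, hw, τ, hτ, -⟩ := hT.exists_max_component hρ
  have hτα : vec τ (hT.dag α) = 0 := by
    have h2 := hT.nonneg_of_mem_stCone hτ (hT.dag α)
    rw [Pi.sub_apply, Pi.smul_apply, hρα, smul_eq_mul] at h2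
    nlinarith [hT.vec_dag_nonneg τ α]
  have hτe : vec τ (hT.dag o) + vec τ (hT.dag o') = 1 := by
    have h2 := hT.dag_add_le_discard h hτ
    unfold IsNormalized at hρ
    simp only [Pi.sub_apply, Pi.smul_apply, smul_eq_mul, hT.vec_discard, hρ] at h2
    have h3 := hT.dag_add_le h τ
    have h4 : w * 1 ≤ w * (vec τ (hT.dag o) + vec τ (hT.dag o')) := by linarith
    exact le_antisymm h3 (le_of_mul_le_mul_left h4 hw)
  have hρτ : T.stFun ρ (hT.dag τ) = 1 := by
    rw [e, Pi.sub_apply, Pi.add_apply, hT.vec_dag_add_eq_one h hτe, hT.orth_symm hτα, sub_zero]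
  have hρ' := hT.eq_of_stFun_dag_eq_one hρτ
  have hτ' : vec τ = vec o + vec o' - vec α := by rw [← e, hρ']; rfl
  refine ⟨τ, hτ', hτα, fun s => ?_⟩
  -- The same description of the antipode in the conjugate system determines its dagger.
  obtain ⟨K⟩ := hT.exists_conjugate A
  obtain ⟨π, -, eπ⟩ := hT.exists_of_mem_stCone_of_eq_one (K.add_sub_mem h hα) (by
    simp only [Pi.sub_apply, Pi.add_apply, hT.vec_discard]; norm_num)
  have h5 : T.stFun π (hT.dag (K.conj τ)) = 1 := by
    rw [eπ]
    simp only [Pi.sub_apply, Pi.add_apply, K.vec_conj_dag, hτα, hτe, sub_zero]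
  have h6 : vec (K.conj τ) = vec (K.conj o) + vec (K.conj o') - vec (K.conj α) := by
    rw [← eπ, hT.eq_of_stFun_dag_eq_one h5]; rfl
  have h7 := congrFun h6 (hT.dag (K.conj s))
  simpa only [Pi.sub_apply, Pi.add_apply, K.vec_conj_dag] using h7

/-- Every normalised state has a pure component of largest weight, which is orthogonal to the
remainder. -/
theorem exists_top {A : C} {ρ : T.St A} (hρ : hT.IsNormalized ρ) :
    ∃ (w : ℝ) (τ : T.PurSt₁ A), 0 < w ∧ T.stFun ρ - w • vec τ ∈ T.stCone A ∧
      T.stFun ρ (hT.dag τ) = w := by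
  obtain ⟨w, hw, τ, hτ, hmax⟩ := hT.exists_max_component hρ
  obtain ⟨B, Ψ, hΨ, -, rfl⟩ := hT.exists_purification hρ
  refine ⟨w, τ, hw, hτ, (hT.exists_partner hΨ (hT.isPure_dag τ) (hT.vec_dag_self τ) hw ?_ hmax).1⟩
  have h1 := hT.nonneg_of_mem_stCone hτ (hT.dag τ)
  rw [Pi.sub_apply, Pi.smul_apply, hT.vec_dag_self, smul_eq_mul, mul_one, stFun_apply] at h1
  linarith

/-- The states of the face of `o` and `o'` are the mixtures of two antipodal pure states. -/
theorem exists_eigenstates {A : C} {o o' : T.PurSt₁ A} (h : vec o (hT.dag o') = 0) {ρ : T.St A}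
    (hρ : hT.IsNormalized ρ) (hρe : T.stFun ρ (hT.dag o) + T.stFun ρ (hT.dag o') = 1) :
    ∃ (μ : ℝ) (τ τ' : T.PurSt₁ A), vec τ' = vec o + vec o' - vec τ ∧ vec τ' (hT.dag τ) = 0 ∧
      (∀ s, vec s (hT.dag τ') = vec s (hT.dag o) + vec s (hT.dag o') - vec s (hT.dag τ)) ∧
      T.stFun ρ = μ • vec τ + (1 - μ) • vec τ' := by
  obtain ⟨w, τ, hw, hτ, hwτ⟩ := hT.exists_top hρ
  have hρu : T.stFun ρ (hT.discard A) = 1 := hρ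
  have hτe : vec τ (hT.dag o) + vec τ (hT.dag o') = 1 := by
    have h2 := hT.dag_add_le_discard h hτ
    simp only [Pi.sub_apply, Pi.smul_apply, smul_eq_mul, hT.vec_discard, hρu] at h2
    have h3 := hT.dag_add_le h τ
    have h4 : w * 1 ≤ w * (vec τ (hT.dag o) + vec τ (hT.dag o')) := by linarith
    exact le_antisymm h3 (le_of_mul_le_mul_left h4 hw)
  obtain ⟨τ', e1, e2, e3⟩ := hT.exists_antipode h hτe
  refine ⟨w, τ, τ', e1, e2, e3, ?_⟩
  obtain ⟨-, σ, hσ, eσ⟩ := hT.exists_of_mem_stCone hτ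
  have hu : (T.stFun ρ - w • vec τ) (hT.discard A) = 1 - w := by
    rw [Pi.sub_apply, Pi.smul_apply, hρu, hT.vec_discard, smul_eq_mul, mul_one]
  rw [hu] at eσ
  rw [← sub_eq_iff_eq_add', eσ]
  by_cases hw1 : 1 - w = 0
  · rw [hw1, zero_smul, zero_smul]
  congr 1
  have h5 : T.stFun σ (hT.dag τ) = 0 := by
    have := congrFun eσ (hT.dag τ)
    rw [Pi.sub_apply, Pi.smul_apply, Pi.smul_apply, hwτ, hT.vec_dag_self, smul_eq_mul, mul_one,
      sub_self, smul_eq_mul] at this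
    exact (mul_eq_zero.1 this.symm).resolve_left hw1
  have h6 : T.stFun σ (hT.dag o) + T.stFun σ (hT.dag o') = 1 := by
    have k1 := congrFun eσ (hT.dag o)
    have k2 := congrFun eσ (hT.dag o')
    simp only [Pi.sub_apply, Pi.smul_apply, smul_eq_mul] at k1 k2
    refine mul_left_cancel₀ hw1 ?_
    linear_combination -k1 - k2 + hρe - w * hτe
  have h7 := hT.eq_zero_of_forall_vec
    (.proj (hT.dag τ') - .proj (hT.dag o) - .proj (hT.dag o') + .proj (hT.dag τ))
    (fun s => by have := e3 s; simp; linarith) (stFun_mem_stCone σ)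
  simp at h7
  have h8 : T.stFun σ (hT.dag τ') = 1 := by linarith
  rw [hT.eq_of_stFun_dag_eq_one h8]; rfl

/-! ### Phase flips -/

/-- Reversible channels preserve daggers. -/
theorem dag_reversible {A : C} {U : A ⟶ A} (hU : T.IsReversible U) {α α' : T.PurSt₁ A}
    (h : vec α' = push U (vec α)) : U ≫ hT.dag α' = hT.dag α := by
  obtain ⟨hU, V, hV, h1, h2⟩ := hU
  refine hT.eq_dag (hT.isPure_iso_comp (hT.isPure_dag α') U V hV h1 h2) ?_
  exact (congrFun h (hT.dag α')).symm.trans (hT.vec_dag_self α')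

theorem vec_dag_reversible {A : C} {U : A ⟶ A} (hU : T.IsReversible U) {α α' β β' : T.PurSt₁ A}
    (hα : vec α' = push U (vec α)) (hβ : vec β' = push U (vec β)) :
    vec β' (hT.dag α') = vec β (hT.dag α) := by
  rw [hβ, ← hT.dag_reversible hU hα]; rfl

theorem dag_tenS {A B : C} {α : T.PurSt₁ A} {β : T.PurSt₁ B} {ω : T.PurSt₁ (A ⊗ B)}
    (h : ω.1 = tenS α.1 β.1) : hT.dag ω = tenE (hT.dag α) (hT.dag β) := by
  refine (hT.eq_dag (hT.isPure_tenE (hT.isPure_dag α) (hT.isPure_dag β)) ?_).symm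
  have h1 : T.pair (hT.dag α) α.1 = 1 := hT.vec_dag_self α
  have h2 : T.pair (hT.dag β) β.1 = 1 := hT.vec_dag_self β
  rw [vec, stFun_apply, h, hT.pair_tenE_tenS, h1, h2, mul_one]

theorem exists_tenS {A B : C} (α : T.PurSt₁ A) (β : T.PurSt₁ B) :
    ∃ ω : T.PurSt₁ (A ⊗ B), ω.1 = tenS α.1 β.1 :=
  ⟨hT.mkPure ⟨hT.isPure_tenS α.2.1 β.2.1,
    hT.isNormalized_tenS (hT.isPureState α).2 (hT.isPureState β).2⟩, rfl⟩

/-- If the face of `o` and `o'` contains the marginal of `Ψ` on `A`, then `o†` and `o'†` resolve the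
deterministic effect on `Ψ`. -/
theorem pair_discard_of_marginal {A B : C} {Ψ : T.St (A ⊗ B)} {o o' : T.PurSt₁ A}
    (h : vec o (hT.dag o') = 0)
    (he : T.pair (hT.dag o) (condR (hT.discard B) Ψ) +
      T.pair (hT.dag o') (condR (hT.discard B) Ψ) =
        T.pair (hT.discard A) (condR (hT.discard B) Ψ)) (b : T.Eff B) :
    T.pair (hT.dag o) (condR b Ψ) + T.pair (hT.dag o') (condR b Ψ) =
      T.pair (hT.discard A) (condR b Ψ) := by
  obtain ⟨b', hb⟩ := hT.exists_compl b
  have h1 := hT.dag_add_le_discard h (stFun_mem_stCone (condR b Ψ))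
  have h2 := hT.dag_add_le_discard h (stFun_mem_stCone (condR b' Ψ))
  have k1 := hb (condL (hT.dag o) Ψ)
  have k2 := hb (condL (hT.dag o') Ψ)
  have k3 := hb (condL (hT.discard A) Ψ)
  simp only [pair_condL', stFun_apply] at *
  linarith

/-- The phase flip of two orthogonal pure states `o` and `o'`: the average of a state of their face
and its image is the mixture of `o` and `o'` with the same probabilities.  It maps a purification
`Ω` of `(o + o') / 2` to the antipode of `Ω`. -/
theorem exists_flip {A : C} {o o' : T.PurSt₁ A} (h : vec o (hT.dag o') = 0) :
    ∃ Z : A ⟶ A, T.IsReversible Z ∧ ∀ ξ : T.PurSt₁ A,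
      vec ξ (hT.dag o) + vec ξ (hT.dag o') = 1 →
      push Z (vec ξ) =
        (2 * vec ξ (hT.dag o)) • vec o + (2 * vec ξ (hT.dag o')) • vec o' - vec ξ := by
  have h' := hT.orth_symm h
  obtain ⟨χ, hχ, eχ⟩ := hT.exists_avg (hT.isPureState o).2 (hT.isPureState o').2
  obtain ⟨B, Ω, hΩ, hΩn, rfl⟩ := hT.exists_purification hχ
  have hχval : ∀ a, T.pair a (condR (hT.discard B) Ω) = 1 / 2 * (vec o a + vec o' a) := fun a => by
    have := congrFun eχ a
    rw [← stFun_apply, this, mul_add]; rfl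
  have key : ∀ ξ : T.PurSt₁ A, vec ξ (hT.dag o) + vec ξ (hT.dag o') = 1 →
      ∃ β : T.PurSt₁ B, T.stFun (condL (hT.dag ξ) Ω) = (1 / 2 : ℝ) • vec β ∧
        T.stFun (condR (hT.dag β) Ω) = (1 / 2 : ℝ) • vec ξ := by
    intro ξ hξ
    obtain ⟨-, β, b, hb, hbβ, e1, e2⟩ := hT.exists_partner hΩ (hT.isPure_dag ξ)
      (hT.vec_dag_self ξ) (q := 1 / 2) (by norm_num)
      (by rw [hχval, hT.vec_dag_add_eq_one h hξ]; norm_num)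
      (fun w α' hw => by
        have h1 := hT.nonneg_of_mem_stCone hw (hT.dag α')
        rw [Pi.sub_apply, Pi.smul_apply, hT.vec_dag_self, stFun_apply, hχval, smul_eq_mul] at h1
        have := hT.vec_add_le h α'
        linarith)
    rw [hT.eq_dag hb hbβ] at e2
    exact ⟨β, e1, e2⟩
  obtain ⟨β₁, e1, e1'⟩ := key o (by rw [hT.vec_dag_self, h, add_zero])
  obtain ⟨β₂, e2, e2'⟩ := key o' (by rw [hT.vec_dag_self, h', zero_add])
  obtain ⟨O, hO⟩ := hT.exists_tenS o β₁
  obtain ⟨O', hO'⟩ := hT.exists_tenS o' β₂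
  have hOO : vec O (hT.dag O') = 0 := by
    rw [hT.dag_tenS hO', vec, stFun_apply, hO, hT.pair_tenE_tenS]
    change vec o (hT.dag o') * _ = 0
    rw [h, zero_mul]
  let ω : T.PurSt₁ (A ⊗ B) := hT.mkPure ⟨hΩ, hΩn⟩
  obtain ⟨ω', hω', -, -⟩ := hT.exists_antipode (α := ω) hOO (by
    rw [hT.dag_tenS hO, hT.dag_tenS hO']
    change T.pair _ Ω + T.pair _ Ω = 1
    rw [← pair_condL, ← pair_condL, ← stFun_apply, ← stFun_apply, e1, e2, Pi.smul_apply,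
      Pi.smul_apply, hT.vec_dag_self, hT.vec_dag_self]
    norm_num)
  have hω'val : ∀ a b, T.pair (tenE a b) ω'.1 =
      vec o a * vec β₁ b + vec o' a * vec β₂ b - T.pair (tenE a b) Ω := fun a b => by
    have h1 := congrFun hω' (tenE a b)
    simp only [Pi.sub_apply, Pi.add_apply, vec, stFun_apply, hO, hO', hT.pair_tenE_tenS] at h1
    exact h1
  have hmarg : condL (hT.discard A) Ω = condL (hT.discard A) ω'.1 := by
    refine hT.st_ext ?_
    ext b
    have h1 := hT.pair_discard_of_marginal (Ψ := Ω) h (by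
      rw [hχval, hχval, hχval, hT.vec_dag_self, hT.vec_dag_self, h, h', hT.vec_discard,
        hT.vec_discard]; norm_num) b
    have k1 := congrFun e1 b
    have k2 := congrFun e2 b
    simp only [stFun_apply, Pi.smul_apply, smul_eq_mul, pair_condL'] at k1 k2
    rw [stFun_apply, stFun_apply, pair_condL, pair_condL, hω'val, hT.vec_discard, hT.vec_discard,
      ← pair_condR, ← h1, k1, k2]
    ring
  obtain ⟨Z, hZ, eZ⟩ := hT.exists_reversible_left ⟨hΩ, hΩn⟩ (hT.isPureState ω') hmarg
  refine ⟨Z, hZ, fun ξ hξ => ?_⟩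
  obtain ⟨β, -, eβ⟩ := key ξ hξ
  ext a
  have k0 := congrFun eβ (Z ≫ a)
  have k1 := congrFun eβ a
  have k2 := congrFun eβ (hT.dag o)
  have k3 := congrFun eβ (hT.dag o')
  have k4 := congrFun e1 (hT.dag β)
  have k5 := congrFun e2 (hT.dag β)
  have k6 := hω'val a (hT.dag β)
  rw [eZ, pair_tenE_whiskerRight, ← pair_condR, ← pair_condR] at k6
  simp only [stFun_apply, Pi.smul_apply, smul_eq_mul, pair_condL'] at k0 k1 k2 k3 k4 k5
  rw [k2] at k4
  rw [k3] at k5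
  rw [k0, k1] at k6
  change vec ξ (Z ≫ a) = _
  simp only [Pi.sub_apply, Pi.add_apply, Pi.smul_apply, smul_eq_mul]
  linear_combination 2 * k6 - 4 * vec o a * k4 - 4 * vec o' a * k5

end IsSharpWithPurification
end OPTData

namespace OPTData

variable {C : Type u} [Category.{v} C] [MonoidalCategory C] [SymmetricCategory C] {T : OPTData C}

namespace IsSharpWithPurification

variable (hT : T.IsSharpWithPurification)

/-! ### Symmetry of transition probabilities -/

include hT

/-- A system with two pure states has two orthogonal ones: one is the largest component of the
average of the two, another a component of the remainder. -/
theorem exists_orth {A : C} {α β : T.PurSt₁ A} (h : α ≠ β) :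
    ∃ o o' : T.PurSt₁ A, vec o (hT.dag o') = 0 := by
  obtain ⟨ρ, hρ, eρ⟩ := hT.exists_avg (hT.isPureState α).2 (hT.isPureState β).2
  obtain ⟨w, γ, -, hγ, hwγ⟩ := hT.exists_top hρ
  have hw1 : 1 - w ≠ 0 := by
    intro h0
    have h1 := hT.eq_of_stFun_dag_eq_one (hwγ.trans (sub_eq_zero.1 h0).symm)
    have hp : hT.IsPureState ρ := h1 ▸ hT.isPureState γ
    exact h (Subtype.ext ((hT.eq_of_avg hp (hT.isPureState α).2 eρ).trans
      (hT.eq_of_avg hp (hT.isPureState β).2 (eρ.trans (add_comm _ _))).symm))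
  obtain ⟨-, σ, hσ, eσ⟩ := hT.exists_of_mem_stCone hγ
  have hρu : T.stFun ρ (hT.discard A) = 1 := hρ
  have hσγ : T.stFun σ (hT.dag γ) = 0 := by
    have h1 := congrFun eσ (hT.dag γ)
    simp only [Pi.sub_apply, Pi.smul_apply, hwγ, hT.vec_dag_self, smul_eq_mul, mul_one, sub_self,
      hρu, hT.vec_discard] at h1
    exact (mul_eq_zero.1 h1.symm).resolve_left hw1
  obtain ⟨w', hw', κ, hκ, -⟩ := hT.exists_max_component hσ
  refine ⟨κ, γ, le_antisymm ?_ (hT.vec_dag_nonneg _ _)⟩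
  have h1 := hT.nonneg_of_mem_stCone hκ (hT.dag γ)
  rw [Pi.sub_apply, Pi.smul_apply, hσγ, smul_eq_mul] at h1
  nlinarith

/-- Suppose that the effect `κ† ⊗ u` steers `Θ` to `α / 2`.  Then some product pure state `κ ⊗ ε`
has a dagger that steers `Θ` to `α / 2`, too. -/
theorem exists_steering_product {A K E : C} {Θ : T.St (A ⊗ K ⊗ E)} (hΘ : T.IsPure Θ)
    {κ : T.PurSt₁ K} {α : T.PurSt₁ A}
    (h : T.stFun (condR (tenE (hT.dag κ) (hT.discard E)) Θ) = (1 / 2 : ℝ) • vec α) :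
    ∃ (ε : T.PurSt₁ E) (ω : T.PurSt₁ (K ⊗ E)), ω.1 = tenS κ.1 ε.1 ∧
      T.stFun (condR (hT.dag ω) Θ) = (1 / 2 : ℝ) • vec α := by
  obtain ⟨ε, hε⟩ := hT.exists_vec_of_isPure
    (hT.isPure_condL (hT.isPure_dag κ) (hT.isPure_condL (hT.isPure_dag α) hΘ))
  obtain ⟨ω, hω⟩ := hT.exists_tenS κ ε
  refine ⟨ε, ω, hω, ?_⟩
  have hd := hT.dag_tenS hω
  have hn : T.pair (hT.discard E) (condL (hT.dag κ) (condL (hT.dag α) Θ)) = 1 / 2 := by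
    rw [pair_condL, pair_condL', ← stFun_apply, h, Pi.smul_apply, hT.vec_dag_self, smul_eq_mul,
      mul_one]
  rw [hn] at hε
  have h1 : T.pair (hT.dag α) (condR (hT.dag ω) Θ) = 1 / 2 := by
    rw [hd, ← pair_condL', ← pair_condL, ← stFun_apply, hε, Pi.smul_apply, hT.vec_dag_self,
      smul_eq_mul, mul_one]
  have h2 : T.pair (hT.discard A) (condR (hT.dag ω) Θ) ≤ 1 / 2 := by
    have h3 := hT.pair_le_discard (hT.dag ε) (condL (hT.dag κ) (condL (hT.discard A) Θ))
    rw [pair_condL (hT.dag κ), pair_condL', pair_condL (hT.dag κ), pair_condL', ← hd] at h3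
    refine h3.trans_eq ?_
    rw [← stFun_apply, h, Pi.smul_apply, hT.vec_discard, smul_eq_mul, mul_one]
  obtain ⟨s, hs⟩ := hT.exists_vec_of_isPure (hT.isPure_condR (hT.isPure_dag ω) hΘ)
  have h3 := congrFun hs (hT.dag α)
  rw [stFun_apply, h1, Pi.smul_apply, smul_eq_mul] at h3
  have h4 := hT.vec_dag_nonneg s α
  have h5 := hT.vec_dag_le_one s α
  have h6 : vec s (hT.dag α) = 1 := by nlinarith
  rw [hs, hT.eq_of_vec_dag_eq_one h6]
  rw [h6, mul_one] at h3
  rw [← h3]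

/-- Two pure states are steered to from one pure state `Θ`, with equal probabilities, by the daggers
of two orthogonal pure states: `Θ` purifies `(α ⊗ o + β ⊗ o') / 2`. -/
theorem exists_orth_steering {A : C} {α β o o' : T.PurSt₁ A} (h : vec o (hT.dag o') = 0) :
    ∃ (R : C) (Θ : T.St (A ⊗ R)) (β₀ β₁ : T.PurSt₁ R), hT.IsPureState Θ ∧
      vec β₀ (hT.dag β₁) = 0 ∧
      T.stFun (condR (hT.dag β₀) Θ) = (1 / 2 : ℝ) • vec α ∧
      T.stFun (condR (hT.dag β₁) Θ) = (1 / 2 : ℝ) • vec β ∧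
      T.stFun (condR (hT.discard R) Θ) = (1 / 2 : ℝ) • vec α + (1 / 2 : ℝ) • vec β := by
  have h' := hT.orth_symm h
  obtain ⟨ρ, hρ, eρ⟩ := hT.exists_avg
    (hT.isNormalized_tenS (hT.isPureState α).2 (hT.isPureState o).2)
    (hT.isNormalized_tenS (hT.isPureState β).2 (hT.isPureState o').2)
  have hval : ∀ k a, T.pair a (condR k ρ) =
      1 / 2 * (vec α a * vec o k) + 1 / 2 * (vec β a * vec o' k) := fun k a => by
    have := congrFun eρ (tenE a k)
    rw [Pi.add_apply, Pi.smul_apply, Pi.smul_apply, stFun_apply, stFun_apply, stFun_apply,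
      hT.pair_tenE_tenS, hT.pair_tenE_tenS, ← pair_condR] at this
    exact this
  obtain ⟨E, Θ₀, hp, hn, rfl⟩ := hT.exists_purification hρ
  let Θ : T.St (A ⊗ A ⊗ E) := Θ₀ ≫ (α_ A A E).hom
  have hΘ : hT.IsPureState Θ :=
    ⟨hT.isPure_comp_iso hp _ (α_ A A E).inv (hT.channel_associator A A E).2 (by simp) (by simp),
      hT.isNormalized_comp hn (hT.channel_associator A A E).1⟩
  have hΘval : ∀ k, condR (tenE k (hT.discard E)) Θ = condR k (condR (hT.discard E) Θ₀) :=
    fun k => condR_tenE_associator k _ Θ₀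
  obtain ⟨ε₀, β₀, eβ₀, h₀⟩ := hT.exists_steering_product hΘ.1 (κ := o) (α := α) (by
    ext a
    rw [hΘval, stFun_apply, hval, hT.vec_dag_self, h', Pi.smul_apply, smul_eq_mul]; ring)
  obtain ⟨ε₁, β₁, eβ₁, h₁⟩ := hT.exists_steering_product hΘ.1 (κ := o') (α := β) (by
    ext a
    rw [hΘval, stFun_apply, hval, hT.vec_dag_self, h, Pi.smul_apply, smul_eq_mul]; ring)
  refine ⟨_, Θ, β₀, β₁, hΘ, ?_, h₀, h₁, ?_⟩
  · rw [hT.dag_tenS eβ₁, vec, stFun_apply, eβ₀, hT.pair_tenE_tenS]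
    change vec o (hT.dag o') * _ = 0
    rw [h, zero_mul]
  · ext a
    rw [← hT.tenE_discard, hΘval, stFun_apply, hval, hT.vec_discard, hT.vec_discard]
    simp

/-- Transition probabilities are symmetric.  For `Θ` as in `exists_orth_steering`, the marginal on
the steering system is a mixture `μ τ + (1 - μ) τ'` of antipodal states of the face of `β₀` and
`β₁`.  If `μ = 1 / 2`, then no dagger occurs on the marginal on `A` with probability above `1 / 2`,
and both transition probabilities vanish.  Otherwise `τ` lies on the equator between `β₀` and `β₁`, and
the phase flip of `τ` and `τ'` fixes the marginal and exchanges `β₀` and `β₁`; by uniqueness of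
purification a reversible channel on `A` exchanges `α` and `β`. -/
theorem vec_dag_symm {A : C} (α β : T.PurSt₁ A) : vec β (hT.dag α) = vec α (hT.dag β) := by
  by_cases hαβ : α = β
  · rw [hαβ]
  obtain ⟨o, o', ho⟩ := hT.exists_orth hαβ
  obtain ⟨R, Θ, β₀, β₁, hΘ, hβ, h₀, h₁, hA⟩ := hT.exists_orth_steering (α := α) (β := β) ho
  have hβ' := hT.orth_symm hβ
  have hR := hT.isNormalized_condL_discard hΘ.2
  have hR₀ : T.stFun (condL (hT.discard A) Θ) (hT.dag β₀) = 1 / 2 := by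
    rw [stFun_apply, pair_condL', ← stFun_apply, h₀, Pi.smul_apply, hT.vec_discard, smul_eq_mul,
      mul_one]
  have hR₁ : T.stFun (condL (hT.discard A) Θ) (hT.dag β₁) = 1 / 2 := by
    rw [stFun_apply, pair_condL', ← stFun_apply, h₁, Pi.smul_apply, hT.vec_discard, smul_eq_mul,
      mul_one]
  obtain ⟨μ, τ, τ', e1, e2, e3, e4⟩ := hT.exists_eigenstates hβ hR (by rw [hR₀, hR₁]; norm_num)
  by_cases hμ : μ = 1 / 2
  · have key : ∀ γ : T.PurSt₁ A, 1 / 2 * vec α (hT.dag γ) + 1 / 2 * vec β (hT.dag γ) ≤ 1 / 2 := by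
      intro γ
      obtain ⟨δ, hδ⟩ := hT.exists_vec_of_isPure (hT.isPure_condL (hT.isPure_dag γ) hΘ.1)
      have h1 := congrFun hδ (hT.dag δ)
      rw [Pi.smul_apply, hT.vec_dag_self, smul_eq_mul, mul_one, stFun_apply, pair_condL',
        pair_condL', ← stFun_apply (condR (hT.discard R) Θ), hA] at h1
      have h2 := hT.pair_le_discard (hT.dag γ) (condR (hT.dag δ) Θ)
      rw [h1, ← pair_condL', ← stFun_apply, e4, e1, hμ] at h2
      have h3 := hT.vec_add_le hβ δ
      simp only [Pi.add_apply, Pi.sub_apply, Pi.smul_apply, smul_eq_mul] at h2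
      linarith
    have h1 := key α
    have h2 := key β
    rw [hT.vec_dag_self] at h1 h2
    have h3 := hT.vec_dag_nonneg α β
    have h4 := hT.vec_dag_nonneg β α
    linarith
  have hμ' : 2 * μ - 1 ≠ 0 := fun h => hμ (by linarith)
  have hτ₀ : vec τ (hT.dag β₀) = 1 / 2 := by
    rw [e4, e1] at hR₀
    simp only [Pi.add_apply, Pi.sub_apply, Pi.smul_apply, smul_eq_mul, hT.vec_dag_self, hβ'] at hR₀
    exact mul_left_cancel₀ hμ' (by linear_combination hR₀)
  have hτ₁ : vec τ (hT.dag β₁) = 1 / 2 := by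
    rw [e4, e1] at hR₁
    simp only [Pi.add_apply, Pi.sub_apply, Pi.smul_apply, smul_eq_mul, hT.vec_dag_self, hβ] at hR₁
    exact mul_left_cancel₀ hμ' (by linear_combination hR₁)
  -- The phase flip of `β₀` and `β₁` exchanges `τ` and `τ'`, so these are unbiased with respect to
  -- `β₀` and `β₁` also as effects.
  obtain ⟨Z, hZ, hZf⟩ := hT.exists_flip hβ
  have hZτ : vec τ' = push Z (vec τ) := by
    rw [hZf τ (by rw [hτ₀, hτ₁]; norm_num), e1, hτ₀, hτ₁]; simp
  have hZ₀ : vec β₀ = push Z (vec β₀) := by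
    rw [hZf β₀ (by rw [hT.vec_dag_self, hβ, add_zero]), hT.vec_dag_self, hβ, mul_zero, zero_smul,
      mul_one, two_smul]
    abel
  have hZ₁ : vec β₁ = push Z (vec β₁) := by
    rw [hZf β₁ (by rw [hT.vec_dag_self, hβ', zero_add]), hT.vec_dag_self, hβ', mul_zero, zero_smul,
      mul_one, two_smul]
    abel
  have hβ₀τ : vec β₀ (hT.dag τ) = 1 / 2 := by
    have h1 := hT.vec_dag_reversible hZ hZτ hZ₀
    rw [e3, hT.vec_dag_self, hβ] at h1
    linarith
  have hβ₁τ : vec β₁ (hT.dag τ) = 1 / 2 := by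
    have h1 := hT.vec_dag_reversible hZ hZτ hZ₁
    rw [e3, hT.vec_dag_self, hβ'] at h1
    linarith
  have hβ₀τ' : vec β₀ (hT.dag τ') = 1 / 2 := by
    rw [e3, hT.vec_dag_self, hβ, hβ₀τ]; norm_num
  have hβ₁τ' : vec β₁ (hT.dag τ') = 1 / 2 := by
    rw [e3, hT.vec_dag_self, hβ', hβ₁τ]; norm_num
  obtain ⟨W, hW, hWf⟩ := hT.exists_flip e2
  have e2' := hT.orth_symm e2
  have hW₀ : vec β₁ = push W (vec β₀) := by
    rw [hWf β₀ (by rw [hβ₀τ, hβ₀τ']; norm_num), hβ₀τ, hβ₀τ', e1]; simp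
  have hW₁ : vec β₀ = push W (vec β₁) := by
    rw [hWf β₁ (by rw [hβ₁τ, hβ₁τ']; norm_num), hβ₁τ, hβ₁τ', e1]; simp
  have hWτ : push W (vec τ) = vec τ := by
    rw [hWf τ (by rw [hT.vec_dag_self, e2', zero_add]), hT.vec_dag_self, e2', mul_zero, zero_smul,
      mul_one, two_smul]
    abel
  have hWτ' : push W (vec τ') = vec τ' := by
    rw [hWf τ' (by rw [hT.vec_dag_self, e2, add_zero]), hT.vec_dag_self, e2, mul_zero, zero_smul,
      mul_one, two_smul]
    abel
  have hWR : push W (T.stFun (condL (hT.discard A) Θ)) = T.stFun (condL (hT.discard A) Θ) := by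
    rw [e4, map_add, map_smul, map_smul, hWτ, hWτ']
  have hΘW : hT.IsPureState (Θ ≫ A ◁ W) := by
    obtain ⟨hc, V, hV, hWV, hVW⟩ := hW
    have hc' : T.IsChannel (A ◁ W) := by
      rw [← id_tensorHom]; exact hT.channel_tensor (hT.channel_id A) hc
    have hV' : T.IsChannel (A ◁ V) := by
      rw [← id_tensorHom]; exact hT.channel_tensor (hT.channel_id A) hV
    refine ⟨hT.isPure_comp_iso hΘ.1 _ (A ◁ V) hV' ?_ ?_, hT.isNormalized_comp hΘ.2 hc'⟩
    · rw [← whiskerLeft_comp, hWV, whiskerLeft_id]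
    · rw [← whiskerLeft_comp, hVW, whiskerLeft_id]
  obtain ⟨U, hU, eU⟩ := hT.exists_reversible_left hΘ hΘW (hT.st_ext (by
    ext b
    rw [stFun_apply (condL _ (Θ ≫ A ◁ W)), pair_condL, pair_tenE_whiskerLeft, ← pair_condL]
    conv_lhs => rw [← hWR]
    rfl))
  have hsteer : ∀ a b, T.pair (U ≫ a) (condR b Θ) = T.pair a (condR (W ≫ b) Θ) := fun a b => by
    rw [pair_condR, pair_condR, ← pair_tenE_whiskerRight, ← eU, pair_tenE_whiskerLeft]
  have hUα : vec β = push U (vec α) := by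
    ext a
    have h1 := hsteer a (hT.dag β₀)
    rw [hT.dag_reversible hW hW₁, ← stFun_apply, ← stFun_apply, h₀, h₁] at h1
    simp only [Pi.smul_apply, smul_eq_mul] at h1
    exact mul_left_cancel₀ (by norm_num : (1 / 2 : ℝ) ≠ 0) h1.symm
  have hUβ : vec α = push U (vec β) := by
    ext a
    have h1 := hsteer a (hT.dag β₁)
    rw [hT.dag_reversible hW hW₀, ← stFun_apply, ← stFun_apply, h₀, h₁] at h1
    simp only [Pi.smul_apply, smul_eq_mul] at h1
    exact mul_left_cancel₀ (by norm_num : (1 / 2 : ℝ) ≠ 0) h1.symm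
  exact (hT.vec_dag_reversible hU hUα hUβ).symm

end IsSharpWithPurification
end OPTData

namespace OPTData

variable {C : Type u} [Category.{v} C] [MonoidalCategory C] [SymmetricCategory C] {T : OPTData C}

namespace IsSharpWithPurification

variable (hT : T.IsSharpWithPurification)

/-! ### Diagonalisation -/

/-- Pairwise orthogonality of a finite set of pure states. -/
def IsOrthogonal {A : C} (S : Finset (T.PurSt₁ A)) : Prop :=
  (S : Set (T.PurSt₁ A)).Pairwise fun o o' => vec o (hT.dag o') = 0

theorem sum_smul_vec_dag {hT : T.IsSharpWithPurification} {A : C} {S : Finset (T.PurSt₁ A)}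
    (hS : hT.IsOrthogonal S) (c : T.PurSt₁ A → ℝ) {o : T.PurSt₁ A} (ho : o ∈ S) :
    (∑ s ∈ S, c s • vec s) (hT.dag o) = c o := by
  rw [Finset.sum_apply, Finset.sum_eq_single_of_mem o ho, Pi.smul_apply, hT.vec_dag_self,
    smul_eq_mul, mul_one]
  intro s hs hso
  rw [Pi.smul_apply, hS hs ho hso, smul_zero]

/-- Orthogonal pure states are jointly components of the invariant state; this bounds their
number. -/
theorem Conjugate.sub_sum_mem {hT : T.IsSharpWithPurification} {A : C} (K : hT.Conjugate A)
    {S : Finset (T.PurSt₁ A)} (hS : hT.IsOrthogonal S) :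
    T.stFun K.χ - K.p • ∑ o ∈ S, vec o ∈ T.stCone A := by
  induction S using Finset.cons_induction with
  | empty => simpa using stFun_mem_stCone K.χ
  | cons o S ho ih =>
    have hS' : hT.IsOrthogonal S := hS.mono (by simp)
    rw [Finset.sum_cons, smul_add, add_comm, ← sub_sub]
    refine hT.sub_mem_stCone (ih hS') (fun γ => ?_) ?_
    · have h1 : 0 ≤ (∑ o ∈ S, vec o) (hT.dag γ) := by
        rw [Finset.sum_apply]
        exact Finset.sum_nonneg fun o _ => hT.vec_dag_nonneg o γ
      rw [Pi.sub_apply, Pi.smul_apply, K.dag_χ, smul_eq_mul]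
      nlinarith [K.pos]
    · have h1 : (∑ o ∈ S, vec o) (hT.dag o) = 0 := by
        rw [Finset.sum_apply]
        refine Finset.sum_eq_zero fun s hs => hS (by simp [hs]) (by simp) ?_
        rintro rfl
        exact ho hs
      rw [Pi.sub_apply, Pi.smul_apply, K.dag_χ, h1, smul_zero, sub_zero]

theorem Conjugate.card_mul_le {hT : T.IsSharpWithPurification} {A : C} (K : hT.Conjugate A)
    {S : Finset (T.PurSt₁ A)} (hS : hT.IsOrthogonal S) : S.card * K.p ≤ 1 := by
  have h1 := hT.nonneg_of_mem_stCone (K.sub_sum_mem hS) (hT.discard A)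
  have h2 : T.stFun K.χ (hT.discard A) = 1 := K.normalized
  rw [Pi.sub_apply, Pi.smul_apply, h2, Finset.sum_apply] at h1
  simp only [hT.vec_discard, Finset.sum_const, nsmul_eq_mul, mul_one, smul_eq_mul] at h1
  linarith

include hT

/-- An element of the cone that vanishes on the daggers of an orthogonal set is diagonalised by an
enlargement of this set. -/
theorem exists_diagonal_of_mem_stCone {A : C} {S : Finset (T.PurSt₁ A)} (hS : hT.IsOrthogonal S)
    {r : T.Eff A → ℝ} (hr : r ∈ T.stCone A) (hrS : ∀ o ∈ S, r (hT.dag o) = 0) :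
    ∃ S', S ⊆ S' ∧ hT.IsOrthogonal S' ∧ ∃ c : T.PurSt₁ A → ℝ, r = ∑ o ∈ S', c o • vec o := by
  classical
  obtain ⟨K⟩ := hT.exists_conjugate A
  obtain ⟨n, hn⟩ : ∃ n : ℕ, 1 < (S.card + n : ℕ) * K.p := by
    obtain ⟨n, hn⟩ := exists_nat_gt (1 / K.p)
    refine ⟨n, ?_⟩
    rw [div_lt_iff₀ K.pos] at hn
    push_cast
    nlinarith [K.pos, (Nat.cast_nonneg S.card : (0 : ℝ) ≤ S.card)]
  induction n generalizing S r with
  | zero => exact absurd (K.card_mul_le hS) (not_le.2 hn)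
  | succ n ih =>
    obtain ⟨h0, ρ, hρ, eρ⟩ := hT.exists_of_mem_stCone hr
    rcases h0.eq_or_lt with h | h
    · exact ⟨S, subset_rfl, hS, 0, by rw [eρ, ← h]; simp⟩
    obtain ⟨w, τ, hw, hτ, hwτ⟩ := hT.exists_top hρ
    set t := r (hT.discard A)
    have hτS : ∀ o ∈ S, vec τ (hT.dag o) = 0 := by
      intro o ho
      have h1 := hrS o ho
      rw [eρ, Pi.smul_apply, smul_eq_mul] at h1
      have h2 := (mul_eq_zero.1 h1).resolve_left h.ne'
      have h3 := hT.nonneg_of_mem_stCone hτ (hT.dag o)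
      rw [Pi.sub_apply, Pi.smul_apply, h2, smul_eq_mul] at h3
      nlinarith [hT.vec_dag_nonneg τ o]
    have hτn : τ ∉ S := fun hm => by
      have h1 := hτS τ hm
      rw [hT.vec_dag_self] at h1
      exact one_ne_zero h1
    have hS' : hT.IsOrthogonal (Finset.cons τ S hτn) := by
      unfold IsOrthogonal
      rw [Finset.coe_cons]
      exact hS.insert fun o ho _ => ⟨hτS o ho, hT.orth_symm (hτS o ho)⟩
    have e : r - (t * w) • vec τ = t • (T.stFun ρ - w • vec τ) := by
      rw [smul_sub, smul_smul, ← eρ]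
    obtain ⟨S', hSS', hS'o, c, hc⟩ := ih hS' (e ▸ smul_mem_stCone hτ h.le) (fun o ho => by
      rw [e, Pi.smul_apply, Pi.sub_apply, Pi.smul_apply]
      rcases Finset.mem_cons.1 ho with rfl | ho
      · rw [hwτ, hT.vec_dag_self, smul_eq_mul w, mul_one, sub_self, smul_zero]
      · have h1 := hrS o ho
        rw [eρ, Pi.smul_apply, smul_eq_mul] at h1
        rw [(mul_eq_zero.1 h1).resolve_left h.ne', hτS o ho, smul_zero, sub_zero, smul_zero])
      (by rw [Finset.card_cons, add_right_comm]; exact hn)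
    have hτ' : τ ∈ S' := hSS' (Finset.mem_cons_self _ _)
    refine ⟨S', (Finset.subset_cons _).trans hSS', hS'o, fun o => c o + if o = τ then t * w else 0,
      ?_⟩
    simp only [add_smul, Finset.sum_add_distrib, ite_smul, zero_smul, Finset.sum_ite_eq', hτ',
      if_true]
    rw [← hc, sub_add_cancel]

theorem span_stVec_pure (A : C) :
    Submodule.span ℝ (Set.range fun α : T.PurSt₁ A => T.stVec α.1) = ⊤ := by
  have := hT.finiteSystems A
  set P := Submodule.span ℝ (Set.range fun α : T.PurSt₁ A => T.stVec α.1)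
  have h1 : T.StR A ≤ P.map (T.StR A).subtype := by
    refine Submodule.span_le.2 ?_
    rintro _ ⟨ρ, rfl⟩
    obtain ⟨-, σ, hσ, e⟩ := hT.exists_of_mem_stCone (stFun_mem_stCone ρ)
    rw [SetLike.mem_coe, e]
    refine Submodule.smul_mem _ _ ?_
    refine hT.mem_of_forall_isPureState (K := P.map (T.StR A).subtype)
      (Submodule.closed_of_finiteDimensional _) (Submodule.convex _) (fun α hα => ?_) hσ
    exact ⟨T.stVec α, Submodule.subset_span ⟨hT.mkPure hα, rfl⟩, rfl⟩
  rw [eq_top_iff]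
  intro x _
  obtain ⟨y, hy, e⟩ := h1 x.2
  rwa [← Subtype.ext e]

omit hT in
/-- The invariant state is an order unit. -/
theorem Conjugate.exists_add_mem {hT : T.IsSharpWithPurification} {A : C} (K : hT.Conjugate A)
    (ξ : T.StR A) : ∃ c : ℝ, 0 ≤ c ∧ ξ.1 + c • T.stFun K.χ ∈ T.stCone A ∧
      -ξ.1 + c • T.stFun K.χ ∈ T.stCone A := by
  have hξ : ξ ∈ Submodule.span ℝ (Set.range fun α : T.PurSt₁ A => T.stVec α.1) := by
    rw [hT.span_stVec_pure]; trivial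
  induction hξ using Submodule.span_induction with
  | mem x hx =>
    obtain ⟨α, rfl⟩ := hx
    have hp := inv_nonneg.2 K.pos.le
    refine ⟨K.p⁻¹, hp, hT.add_mem_stCone (vec_mem_stCone α)
      (smul_mem_stCone (stFun_mem_stCone _) hp), ?_⟩
    have h1 := smul_mem_stCone (K.sub_mem α) hp
    rw [smul_sub, smul_smul, inv_mul_cancel₀ K.pos.ne', one_smul, sub_eq_neg_add] at h1
    exact h1
  | zero =>
    exact ⟨0, le_rfl, by simpa using hT.zero_mem_stCone A, by simpa using hT.zero_mem_stCone A⟩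
  | add x y _ _ hx hy =>
    obtain ⟨c, hc, h1, h2⟩ := hx
    obtain ⟨c', hc', h1', h2'⟩ := hy
    refine ⟨c + c', add_nonneg hc hc', ?_, ?_⟩
    · convert hT.add_mem_stCone h1 h1' using 1
      rw [Submodule.coe_add]; module
    · convert hT.add_mem_stCone h2 h2' using 1
      rw [Submodule.coe_add]; module
  | smul a x _ hx =>
    obtain ⟨c, hc, h1, h2⟩ := hx
    refine ⟨|a| * c, by positivity, ?_⟩
    rcases le_total 0 a with ha | ha
    · rw [abs_of_nonneg ha]
      constructor
      · convert smul_mem_stCone h1 ha using 1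
        rw [Submodule.coe_smul]; module
      · convert smul_mem_stCone h2 ha using 1
        rw [Submodule.coe_smul]; module
    · rw [abs_of_nonpos ha]
      constructor
      · convert smul_mem_stCone h2 (neg_nonneg.2 ha) using 1
        rw [Submodule.coe_smul]; module
      · convert smul_mem_stCone h1 (neg_nonneg.2 ha) using 1
        rw [Submodule.coe_smul]; module

/-- Every vector of the span of states is a linear combination of orthogonal pure states. -/
theorem exists_diagonal {A : C} (ξ : T.StR A) : ∃ S, hT.IsOrthogonal S ∧
    ∃ c : T.PurSt₁ A → ℝ, ξ = ∑ o ∈ S, c o • T.stVec o.1 := by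
  obtain ⟨K⟩ := hT.exists_conjugate A
  obtain ⟨b, -, hb, -⟩ := K.exists_add_mem ξ
  obtain ⟨S, -, hS, c, hc⟩ := hT.exists_diagonal_of_mem_stCone (S := ∅) (by simp [IsOrthogonal])
    hb (by simp)
  -- The invariant state is diagonalised by an enlargement of the same orthogonal set.
  obtain ⟨S', hSS', hS', c', hc'⟩ := hT.exists_diagonal_of_mem_stCone hS (K.sub_sum_mem hS)
    (fun o ho => by
      have h1 := sum_smul_vec_dag hS (fun _ => 1) ho
      simp only [one_smul] at h1
      rw [Pi.sub_apply, Pi.smul_apply, K.dag_χ, h1, smul_eq_mul, mul_one, sub_self])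
  classical
  refine ⟨S', hS', fun o => (if o ∈ S then c o - b * K.p else 0) - b * c' o, ?_⟩
  have hsum : ∀ g : T.PurSt₁ A → ℝ, ∑ o ∈ S', (if o ∈ S then g o else 0) • vec o =
      ∑ o ∈ S, g o • vec o := fun g => by
    simp only [ite_smul, zero_smul]
    rw [Finset.sum_ite_mem, Finset.inter_eq_right.2 hSS']
  refine Subtype.ext ?_
  rw [AddSubmonoidClass.coe_finsetSum]
  change ξ.1 = ∑ o ∈ S', ((if o ∈ S then c o - b * K.p else 0) - b * c' o) • vec o
  simp only [sub_smul _ (b * _)]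
  rw [Finset.sum_sub_distrib, hsum]
  simp only [sub_smul, mul_smul]
  rw [Finset.sum_sub_distrib, ← Finset.smul_sum, ← Finset.smul_sum, ← Finset.smul_sum, ← hc, ← hc']
  module

/-! ### The linear extension of the dagger -/

theorem bddAbove_pair {A : C} (a : T.Eff A) : BddAbove (Set.range (T.pair a)) :=
  ⟨1, by rintro _ ⟨ρ, rfl⟩; exact hT.pair_le_one a ρ⟩

/-- The norm of an effect is attained. -/
theorem exists_pair_eq_effNorm {A : C} (a : T.Eff A) : ∃ ρ : T.St A, T.pair a ρ = T.effNorm a := by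
  obtain ⟨ρ₀, -⟩ := hT.exists_normalized A
  obtain ⟨_, ⟨ρ, rfl⟩, h⟩ := (hT.isCompact_range_stFun A).exists_isMaxOn ⟨_, ρ₀, rfl⟩
    (continuous_apply a).continuousOn
  have : Nonempty (T.St A) := ⟨ρ₀⟩
  exact ⟨ρ, le_antisymm (le_ciSup (hT.bddAbove_pair a) ρ) (ciSup_le fun σ => h ⟨σ, rfl⟩)⟩

theorem effNorm_dag {A : C} (α : T.PurSt₁ A) : T.effNorm (hT.dag α) = 1 := by
  have : Nonempty (T.St A) := ⟨α.1⟩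
  refine le_antisymm (ciSup_le fun σ => hT.pair_le_one _ _) ?_
  rw [← hT.vec_dag_self α]
  exact le_ciSup (hT.bddAbove_pair _) α.1

/-- The dagger as a bijection from normalised pure states to normalised pure effects. -/
noncomputable def dagEquiv (A : C) : T.PurSt₁ A ≃ T.PurEff₁ A :=
  Equiv.ofBijective (fun α => ⟨hT.dag α, hT.isPure_dag α, hT.effNorm_dag α⟩) <| by
    constructor
    · intro α β h
      have h1 : hT.dag α = hT.dag β := congrArg Subtype.val h
      exact (hT.eq_of_vec_dag_eq_one (by rw [h1, hT.vec_dag_self])).symm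
    · rintro ⟨a, ha, hn⟩
      obtain ⟨ρ, hρ⟩ := hT.exists_pair_eq_effNorm a
      rw [hn] at hρ
      exact ⟨hT.mkPure (hT.isPureState_of_pair_eq_one ha hρ), Subtype.ext
        (hT.eq_dag (α := hT.mkPure (hT.isPureState_of_pair_eq_one ha hρ)) ha hρ).symm⟩

theorem isPureDagger_dagEquiv (A : C) : T.IsPureDagger (hT.dagEquiv A) := by
  intro α a
  constructor
  · intro h
    exact Subtype.ext (hT.eq_dag a.2.1 h)
  · rintro rfl
    exact hT.vec_dag_self α

theorem eq_dagEquiv {A : C} {d : T.PurSt₁ A ≃ T.PurEff₁ A} (hd : T.IsPureDagger d) :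
    d = hT.dagEquiv A := by
  ext1 α
  exact (hT.isPureDagger_dagEquiv A α (d α)).1 ((hd α (d α)).2 rfl)

omit hT in
theorem pairR_effVec {A : C} (a : T.Eff A) (ξ : T.StR A) : T.pairR (T.effVec a) ξ = ξ.1 a := rfl

/-- The dagger of pure states respects linear relations, by the symmetry of transition
probabilities. -/
theorem exists_linear_dag (A : C) : ∃ D : T.StR A →ₗ[ℝ] T.EffR A,
    ∀ α : T.PurSt₁ A, D (T.stVec α.1) = T.effVec (hT.dag α) := by
  let F := Finsupp.linearCombination ℝ fun α : T.PurSt₁ A => T.stVec α.1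
  let G := Finsupp.linearCombination ℝ fun α : T.PurSt₁ A => T.effVec (hT.dag α)
  have hF : LinearMap.range F = ⊤ := by
    rw [Finsupp.range_linearCombination, hT.span_stVec_pure]
  have hFG : ∀ f, F f = 0 → G f = 0 := by
    intro f hf
    refine Subtype.ext (LinearMap.ext_on (hT.span_stVec_pure A) ?_)
    rintro _ ⟨s, rfl⟩
    have h1 : (LinearMap.applyₗ (T.stVec s.1)) ∘ₗ (T.EffR A).subtype ∘ₗ G =
        T.effFun (hT.dag s) ∘ₗ F := by
      refine Finsupp.lhom_ext fun α c => ?_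
      have h2 : T.effFun (hT.dag α) (T.stVec s.1) = T.effFun (hT.dag s) (T.stVec α.1) :=
        hT.vec_dag_symm α s
      simp only [LinearMap.comp_apply, F, G, Finsupp.linearCombination_single, map_smul]
      exact congrArg (c • ·) h2
    have h2 := LinearMap.congr_fun h1 f
    have h3 : T.effFun (hT.dag s) (F f) = 0 := by rw [hf, map_zero]
    exact h2.trans h3
  obtain ⟨g, hg⟩ := F.exists_rightInverse_of_surjective hF
  refine ⟨G ∘ₗ g, fun α => ?_⟩
  have h1 : F (g (T.stVec α.1) - Finsupp.single α 1) = 0 := by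
    rw [map_sub, ← LinearMap.comp_apply, hg]
    simp [F]
  have h2 := hFG _ h1
  rw [map_sub, sub_eq_zero] at h2
  rw [LinearMap.comp_apply, h2]
  simp [G]

section Form

variable {A : C} {D : T.StR A →ₗ[ℝ] T.EffR A}
  (hD : ∀ α : T.PurSt₁ A, D (T.stVec α.1) = T.effVec (hT.dag α))

include hD

theorem pairR_symm (ξ η : T.StR A) : T.pairR (D ξ) η = T.pairR (D η) ξ := by
  let b : T.StR A →ₗ[ℝ] T.StR A →ₗ[ℝ] ℝ := (T.EffR A).subtype ∘ₗ D
  have hb : b = b.flip := by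
    refine LinearMap.ext_on (hT.span_stVec_pure A) ?_
    rintro _ ⟨α, rfl⟩
    refine LinearMap.ext_on (hT.span_stVec_pure A) ?_
    rintro _ ⟨β, rfl⟩
    change T.pairR (D _) _ = T.pairR (D _) _
    rw [hD, hD]
    exact hT.vec_dag_symm α β
  exact LinearMap.congr_fun₂ hb ξ η

/-- In a diagonal decomposition, `(ξ†|ξ)` is the sum of the squares of the coefficients. -/
theorem exists_pairR_self (ξ : T.StR A) : ∃ (S : Finset (T.PurSt₁ A)) (c : T.PurSt₁ A → ℝ),
    ξ = ∑ o ∈ S, c o • T.stVec o.1 ∧ T.pairR (D ξ) ξ = ∑ o ∈ S, c o ^ 2 := by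
  obtain ⟨S, hS, c, hc⟩ := hT.exists_diagonal ξ
  refine ⟨S, c, hc, ?_⟩
  have hξ : ∀ o ∈ S, ξ.1 (hT.dag o) = c o := fun o ho => by
    rw [← sum_smul_vec_dag hS c ho, hc, AddSubmonoidClass.coe_finsetSum]; rfl
  have h1 : D ξ = ∑ o ∈ S, c o • T.effVec (hT.dag o) := by
    conv_lhs => rw [hc]
    rw [map_sum]
    simp only [map_smul, hD]
  have h2 : T.pairR (D ξ) ξ = ∑ o ∈ S, c o • T.pairR (T.effVec (hT.dag o)) ξ := by
    rw [h1, pairR, AddSubmonoidClass.coe_finsetSum, LinearMap.sum_apply]; rfl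
  rw [h2]
  refine Finset.sum_congr rfl fun o ho => ?_
  rw [pairR_effVec, hξ o ho, smul_eq_mul, sq]

theorem pairR_self_nonneg (ξ : T.StR A) : 0 ≤ T.pairR (D ξ) ξ := by
  obtain ⟨S, c, -, h⟩ := hT.exists_pairR_self hD ξ
  rw [h]
  exact Finset.sum_nonneg fun o _ => sq_nonneg _

theorem eq_zero_of_pairR_self {ξ : T.StR A} (h0 : T.pairR (D ξ) ξ = 0) : ξ = 0 := by
  obtain ⟨S, c, hc, h⟩ := hT.exists_pairR_self hD ξ
  rw [h, Finset.sum_eq_zero_iff_of_nonneg fun o _ => sq_nonneg _] at h0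
  rw [hc]
  refine Finset.sum_eq_zero fun o ho => ?_
  rw [pow_eq_zero_iff two_ne_zero |>.1 (h0 o ho), zero_smul]

theorem isInnerProduct_pairR : IsInnerProduct fun ξ η : T.StR A => T.pairR (D ξ) η :=
  ⟨{ inner := fun ξ η => T.pairR (D ξ) η
     conj_inner_symm := fun ξ η => hT.pairR_symm hD η ξ
     re_inner_nonneg := hT.pairR_self_nonneg hD
     add_left := fun ξ ξ' η => by simp [pairR]
     smul_left := fun ξ η c => by simp [pairR]
     definite := fun ξ => hT.eq_zero_of_pairR_self hD }, fun _ _ => rfl⟩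

end Form

/-- The linear extension of the dagger is injective, because `(ξ†|ξ)` vanishes only for `ξ = 0`, and
hence bijective. -/
theorem exists_linearEquiv_dag (A : C) : ∃ D : T.StR A ≃ₗ[ℝ] T.EffR A,
    ∀ α : T.PurSt₁ A, D (T.stVec α.1) = T.effVec (hT.dag α) := by
  have := hT.finiteSystems A
  obtain ⟨D, hD⟩ := hT.exists_linear_dag A
  have hinj : Function.Injective D := by
    rw [injective_iff_map_eq_zero]
    intro ξ h
    refine hT.eq_zero_of_pairR_self hD ?_
    rw [h]; rfl
  -- The functionals `D ξ` exhaust the dual space, for dimensional reasons.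
  have hsurj : Function.Surjective ((T.EffR A).subtype ∘ₗ D) :=
    (LinearMap.injective_iff_surjective_of_finrank_eq_finrank Subspace.dual_finrank_eq.symm).1
      (Subtype.val_injective.comp hinj)
  refine ⟨LinearEquiv.ofBijective D ⟨hinj, fun x => ?_⟩, hD⟩
  obtain ⟨ξ, hξ⟩ := hsurj x
  exact ⟨ξ, Subtype.ext hξ⟩

end IsSharpWithPurification
end OPTData

theorem mainTheorem4 {C : Type u} [Category.{v} C] [MonoidalCategory C] [SymmetricCategory C]
    (T : OPTData C) (hT : T.IsSharpWithPurification) (A : C) :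
    (∃! d : T.PurSt₁ A ≃ T.PurEff₁ A, T.IsPureDagger d) ∧
    ∀ d : T.PurSt₁ A ≃ T.PurEff₁ A, T.IsPureDagger d →
      (∃! D : T.StR A ≃ₗ[ℝ] T.EffR A, T.IsLinearExtension d D) ∧
      ∀ D : T.StR A ≃ₗ[ℝ] T.EffR A, T.IsLinearExtension d D →
        IsInnerProduct (fun ξ η : T.StR A => T.pairR (D ξ) η) ∧
        (∀ ρ σ : T.St A,
          T.pairR (D (T.stVec ρ)) (T.stVec σ) = T.pairR (D (T.stVec σ)) (T.stVec ρ)) ∧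
        (∀ α β : T.PurSt₁ A, T.pair (d α).1 β.1 = T.pair (d β).1 α.1) := by
  refine ⟨⟨hT.dagEquiv A, hT.isPureDagger_dagEquiv A, fun d hd => hT.eq_dagEquiv hd⟩,
    fun d hd => ?_⟩
  obtain rfl := hT.eq_dagEquiv hd
  obtain ⟨D₀, hD₀⟩ := hT.exists_linearEquiv_dag A
  refine ⟨⟨D₀, hD₀, fun D hD => ?_⟩, fun D hD => ?_⟩
  · refine LinearEquiv.toLinearMap_injective (LinearMap.ext_on (hT.span_stVec_pure A) ?_)
    rintro _ ⟨α, rfl⟩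
    exact (hD α).trans (hD₀ α).symm
  · exact ⟨hT.isInnerProduct_pairR (D := D.toLinearMap) hD,
      fun ρ σ => hT.pairR_symm (D := D.toLinearMap) hD _ _, fun α β => hT.vec_dag_symm α β⟩
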